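/- Let $\mathbb T$ be $\mathbb R$ or $\mathbb Z$ (or any Archimedean totally ordered abelian group) and $\mathbb T_+=\{t\in\mathbb T: t\ge 0\}$. Let $\mathcal B_0$ be a $C^*$-algebra (not necessarily unital), $(\lambda_t)_{t\in\mathbb T_+}$ a semigroup of injective $*$-endomorphisms of $\mathcal B_0$ (with $\lambda_0=\mathrm{id}$), and $\psi$ a state on $\mathcal B_0$ with $\psi\circ\lambda_t=\psi$ for all $t\ge 0$. Let $\mathcal B_{[-\infty}$ be the $C^*$-inductive limit of $\mathcal B_0$ along $(\lambda_t)$, that is, the $C^*$-algebra with injective $*$-homomorphisms $i_t:\mathcal B_0\to\mathcal B_{[-\infty}$, $t\in\mathbb T$, such that $i_{s+t}=i_s\circ\lambda_t$ for $s\in\mathbb T$, $t\ge 0$, and $\bigcup_t i_t(\mathcal B_0)$ is norm dense; let $\psi_{[-\infty}$ be the state on $\mathcal B_{[-\infty}$ with $\psi_{[-\infty}\circ i_t=\psi$ for all $t\in\mathbb T$. Let $(\mathcal H,\pi,\Omega)$ be the GNS triple of $(\mathcal B_0,\psi)$, let $P$ be the support projection of the vector state of $\Omega$ in $\pi(\mathcal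 B_0)''$, i.e. the orthogonal projection onto $\mathcal K=\overline{\pi(\mathcal B_0)'\Omega}$, let $\mathcal A_0=P\pi(\mathcal B_0)''P$, and let $\phi_0(x)=\langle\Omega,x\Omega\rangle$ for $x\in\mathcal A_0$. For $t\ge 0$ let $\tau_t:\mathcal A_0\to\mathcal A_0$ be the compressed map $\tau_t(x)=P\lambda_t(PxP)P$; here $X\mapsto P\lambda_t(X)P$ denotes the unique normal linear map $\pi(\mathcal B_0)''\to\mathcal A_0$ that sends $\pi(b)$ to $P\pi(\lambda_t(b))P$ for every $b\in\mathcal B_0$. Consider the condition (WK) there are contractions $x_t\in\mathcal A_0$ $(t\in\mathbb T_+)$ such that for every $s\ge 0$ and all $x,y\in\mathcal A_0$, $$\phi_0\big(\tau_t(x)\,x_{s+t}^*\,x_{s+t}\,\tau_t(y)\big)\longrightarrow\phi_0(x)\,\phi_0(y)\qquad (t\to\infty).$$ If (WK) holds, then $\psi_{[-\infty}$ is a pure state. If $\mathcal K$ is separable, then $\psi_{[-\infty}$ is pure if and only if (WK) holds. -/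

import Mathlib

open Filter Topology
open scoped ComplexOrder InnerProductSpace

namespace WeakKolmogorov

set_option linter.unusedSectionVars false

section CStar

variable {B : Type*} [NonUnitalCStarAlgebra B]

/-- The states of a (not necessarily unital) C⋆-algebra: positive functionals of norm one. -/
def stateSpace (B : Type*) [NonUnitalCStarAlgebra B] : Set (B →L[ℂ] ℂ) :=
  {φ | (∀ b : B, 0 ≤ φ (star b * b)) ∧ ‖φ‖ = 1}

/-- Pure states are the extreme points of the state space. -/
def IsPureState (φ : B →L[ℂ] ℂ) : Prop :=
  φ ∈ (stateSpace B).extremePoints ℝ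

variable {T : Type*} [AddCommGroup T] [LinearOrder T] [IsOrderedAddMonoid T]

/-- `(lam t)`, `t ≥ 0`, is a semigroup of injective `⋆`-endomorphisms. -/
structure IsInjectiveSemigroup (lam : {t : T // 0 ≤ t} → (B →⋆ₙₐ[ℂ] B)) : Prop where
  injective : ∀ t, Function.Injective (lam t)
  map_zero : ∀ b, lam 0 b = b
  map_add : ∀ s t b, lam (s + t) b = lam s (lam t b)

/-- `B'` with the embeddings `i t : B → B'`, `t ∈ T`, is the C⋆-inductive limit of
`B → B → B → ⋯` along `lam`: the `i t` are compatible with `lam` and injective, and the increasing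
union (as `t` decreases) of their ranges `B_{[t}` is norm dense. This determines `(B', i)` up to a
unique isomorphism. -/
structure IsInductiveLimit {B' : Type*} [NonUnitalCStarAlgebra B']
    (lam : {t : T // 0 ≤ t} → (B →⋆ₙₐ[ℂ] B)) (i : T → (B →⋆ₙₐ[ℂ] B')) : Prop where
  injective : ∀ t, Function.Injective (i t)
  compatible : ∀ (s : T) (t : {t : T // 0 ≤ t}) (b : B), i (s + t) b = i s (lam t b)
  dense : Dense (⋃ t, Set.range (i t))

section Completion

variable (D : Type*) [NonUnitalSeminormedRing D] [StarRing D] [NormedStarGroup D] [NormedSpace ℂ D]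
  [IsScalarTower ℂ D D] [SMulCommClass ℂ D D] [StarModule ℂ D]

open UniformSpace

/-- The completion of a pre-C⋆-algebra. -/
def CStarCompletion : Type _ := Completion D

namespace CStarCompletion

noncomputable instance : NormedAddCommGroup (CStarCompletion D) :=
  inferInstanceAs (NormedAddCommGroup (Completion D))
noncomputable instance : NormedSpace ℂ (CStarCompletion D) :=
  inferInstanceAs (NormedSpace ℂ (Completion D))
instance : CompleteSpace (CStarCompletion D) := inferInstanceAs (CompleteSpace (Completion D))

variable {D}

/-- The canonical map into the completion. -/
noncomputable def of : D →ₗᵢ[ℂ] CStarCompletion D := Completion.toComplₗᵢ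

theorem denseRange_of : DenseRange (of : D → CStarCompletion D) := Completion.denseRange_coe

theorem isUniformInducing_of : IsUniformInducing (of : D → CStarCompletion D) :=
  of.isometry.isUniformInducing

variable (D) in
/-- Multiplication as a bilinear map from `D` into its completion. -/
noncomputable def mulL₀ : D →L[ℂ] D →L[ℂ] CStarCompletion D :=
  (ContinuousLinearMap.compL ℂ D D (CStarCompletion D) of.toContinuousLinearMap).comp
    (ContinuousLinearMap.mul ℂ D)

variable (D) in
/-- Multiplication, extended in the second variable. -/
noncomputable def mulL₁ : CStarCompletion D →L[ℂ] D →L[ℂ] CStarCompletion D :=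
  (mulL₀ D).flip.extend of.toContinuousLinearMap

variable (D) in
/-- The multiplication of the completion as a bilinear map. -/
noncomputable def mulL : CStarCompletion D →L[ℂ] CStarCompletion D →L[ℂ] CStarCompletion D :=
  (mulL₁ D).flip.extend of.toContinuousLinearMap

noncomputable instance : Mul (CStarCompletion D) := ⟨fun x y => mulL D x y⟩

theorem continuous_mul' : Continuous fun p : CStarCompletion D × CStarCompletion D => p.1 * p.2 :=
  (mulL D).continuous₂

theorem of_mul (a b : D) : of (a * b) = of a * of b := by
  have h₁ : mulL₁ D (of b) = (mulL₀ D).flip b :=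
    ContinuousLinearMap.extend_eq _ (e := of.toContinuousLinearMap)
      denseRange_of isUniformInducing_of b
  have h : mulL D (of a) = (mulL₁ D).flip a :=
    ContinuousLinearMap.extend_eq _ (e := of.toContinuousLinearMap)
      denseRange_of isUniformInducing_of a
  change of (a * b) = mulL D (of a) (of b)
  rw [h, ContinuousLinearMap.flip_apply, h₁]
  rfl

noncomputable instance : Star (CStarCompletion D) := ⟨Completion.map star⟩

theorem continuous_star' : Continuous (star : CStarCompletion D → CStarCompletion D) :=
  Completion.continuous_map

theorem of_star (a : D) : of (star a) = star (of a) :=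
  (Completion.map_coe (starNormedAddGroupHom (E := D)).uniformContinuous a).symm

/-- The completion of a pre-C⋆-algebra is a C⋆-algebra. -/
@[reducible] noncomputable def nonUnitalCStarAlgebra (hD : ∀ a : D, ‖a‖ * ‖a‖ ≤ ‖star a * a‖) :
    NonUnitalCStarAlgebra (CStarCompletion D) :=
  have hc := continuous_mul' (D := D)
  have hs := continuous_star' (D := D)
  have hm : ∀ {X : Type _} [TopologicalSpace X] {f g : X → CStarCompletion D},
      Continuous f → Continuous g → Continuous fun x => f x * g x :=
    fun hf hg => hc.comp (hf.prodMk hg)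
  { (inferInstance : NormedAddCommGroup (CStarCompletion D)),
    (inferInstance : NormedSpace ℂ (CStarCompletion D)),
    (inferInstance : CompleteSpace (CStarCompletion D)),
    (inferInstance : Mul (CStarCompletion D)),
    (inferInstance : Star (CStarCompletion D)) with
    left_distrib := fun x y z => map_add (mulL D x) y z
    right_distrib := fun x y z => congrArg (· z) (map_add (mulL D) x y)
    zero_mul := fun x => congrArg (· x) (map_zero (mulL D))
    mul_zero := fun x => map_zero (mulL D x)
    mul_assoc := fun x y z => by
      refine denseRange_of.induction_on₃ (p := fun x y z => x * y * z = x * (y * z))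
        (isClosed_eq (hm (hm (by fun_prop) (by fun_prop)) (by fun_prop))
          (hm (by fun_prop) (hm (by fun_prop) (by fun_prop)))) (fun a b c => ?_) x y z
      simp only [← of_mul, mul_assoc]
    norm_mul_le := fun x y => by
      refine denseRange_of.induction_on₂ (p := fun x y => ‖x * y‖ ≤ ‖x‖ * ‖y‖)
        (isClosed_le hc.norm (by fun_prop)) (fun a b => ?_) x y
      rw [← of_mul, of.norm_map, of.norm_map, of.norm_map]
      exact norm_mul_le a b
    star_involutive := fun x => by
      refine denseRange_of.induction_on (p := fun x => star (star x) = x) x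
        (isClosed_eq (hs.comp hs) continuous_id) (fun a => ?_)
      simp only [← of_star, star_star]
    star_mul := fun x y => by
      refine denseRange_of.induction_on₂ (p := fun x y => star (x * y) = star y * star x)
        (isClosed_eq (hs.comp hc) (hm (hs.comp continuous_snd) (hs.comp continuous_fst)))
        (fun a b => ?_) x y
      simp only [← of_mul, ← of_star, star_mul]
    star_add := fun x y => by
      refine denseRange_of.induction_on₂ (p := fun x y => star (x + y) = star x + star y)
        (isClosed_eq (hs.comp continuous_add)
          ((hs.comp continuous_fst).add (hs.comp continuous_snd))) (fun a b => ?_) x y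
      simp only [← map_add, ← of_star, star_add]
    norm_mul_self_le := fun x => by
      refine denseRange_of.induction_on (p := fun x => ‖x‖ * ‖x‖ ≤ ‖star x * x‖) x
        (isClosed_le (by fun_prop) (hm hs continuous_id).norm) (fun a => ?_)
      simpa only [← of_star, ← of_mul, of.norm_map] using hD a
    smul_assoc := fun c x y => congrArg (· y) (map_smul (mulL D) c x)
    smul_comm := fun c x y => (map_smul (mulL D x) c y).symm
    star_smul := fun c x => by
      refine denseRange_of.induction_on (p := fun x => star (c • x) = star c • star x) x
        (isClosed_eq (hs.comp (continuous_const_smul c)) (hs.const_smul (star c))) (fun a => ?_)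
      simp only [← map_smul, ← of_star, star_smul] }

end CStarCompletion
end Completion

section Limit

/-- The `⋆`-algebra of functions `f : T₊ → B` that are eventually coherent for `lam`:
`f (s + r) = lam r (f s)` for all large `s` and all `r`. Modulo eventually vanishing functions, it
is the algebraic inductive limit. -/
def coherent (lam : {t : T // 0 ≤ t} → (B →⋆ₙₐ[ℂ] B)) :
    NonUnitalStarSubalgebra ℂ ({t : T // 0 ≤ t} → B) where
  carrier := {f | ∀ᶠ s in atTop, ∀ r, f (s + r) = lam r (f s)}
  add_mem' hf hg := by filter_upwards [hf, hg] with s h₁ h₂ r using by simp [h₁, h₂]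
  zero_mem' := Eventually.of_forall fun s r => (map_zero (lam r)).symm
  mul_mem' hf hg := by filter_upwards [hf, hg] with s h₁ h₂ r using by simp [h₁, h₂]
  smul_mem' c f hf := by filter_upwards [hf] with s h₁ r using by simp [h₁]
  star_mem' hf := by filter_upwards [hf] with s h₁ r using by simp [h₁, map_star]

variable {lam : {t : T // 0 ≤ t} → (B →⋆ₙₐ[ℂ] B)}

/-- The algebra `coherent lam`, to be equipped with the seminorm `lim ‖f s‖`. -/
def PreLimit (_ : IsInjectiveSemigroup lam) : Type _ := coherent lam

namespace PreLimit

variable (hlam : IsInjectiveSemigroup lam)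

noncomputable instance : NonUnitalRing (PreLimit hlam) :=
  inferInstanceAs (NonUnitalRing (coherent lam))
noncomputable instance : Module ℂ (PreLimit hlam) := inferInstanceAs (Module ℂ (coherent lam))
noncomputable instance : StarRing (PreLimit hlam) := inferInstanceAs (StarRing (coherent lam))
instance : StarModule ℂ (PreLimit hlam) := inferInstanceAs (StarModule ℂ (coherent lam))
instance : IsScalarTower ℂ (PreLimit hlam) (PreLimit hlam) :=
  inferInstanceAs (IsScalarTower ℂ (coherent lam) (coherent lam))
instance : SMulCommClass ℂ (PreLimit hlam) (PreLimit hlam) :=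
  inferInstanceAs (SMulCommClass ℂ (coherent lam) (coherent lam))

variable {hlam}

/-- The underlying function. -/
def val (f : PreLimit hlam) : {t : T // 0 ≤ t} → B := Subtype.val (p := (· ∈ coherent lam)) f

/-- The eventual value of `‖f s‖`. -/
noncomputable def nrm (f : PreLimit hlam) : ℝ := limUnder atTop fun s => ‖val f s‖

theorem eventually_nrm (f : PreLimit hlam) : ∀ᶠ s in atTop, ‖val f s‖ = nrm f := by
  obtain ⟨s, hs⟩ := (Subtype.property (p := (· ∈ coherent lam)) f : ∀ᶠ s in atTop, _).exists
  have h : ∀ᶠ u in atTop, ‖val f u‖ = ‖val f s‖ := by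
    filter_upwards [eventually_ge_atTop s] with u hu
    obtain ⟨r, rfl⟩ : ∃ r, u = s + r :=
      ⟨⟨u.1 - s.1, sub_nonneg.2 hu⟩, Subtype.ext (by simp)⟩
    exact (congrArg norm (hs r)).trans (NonUnitalStarAlgHom.norm_map _ (hlam.injective r) _)
  have : nrm f = ‖val f s‖ :=
    Tendsto.limUnder_eq (tendsto_const_nhds.congr' (h.mono fun u hu => hu.symm))
  rw [this]
  exact h

noncomputable instance : NonUnitalSeminormedRing (PreLimit hlam) :=
  { (inferInstance : NonUnitalRing (PreLimit hlam)),
    AddGroupSeminorm.toSeminormedAddCommGroup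
      { toFun := nrm
        map_zero' := by
          obtain ⟨s, hs⟩ := (eventually_nrm (0 : PreLimit hlam)).exists
          rw [← hs]; exact norm_zero
        neg' := fun f => by
          obtain ⟨s, hs, hs'⟩ := ((eventually_nrm f).and (eventually_nrm (-f))).exists
          rw [← hs, ← hs']; exact norm_neg _
        add_le' := fun f g => by
          obtain ⟨s, hf, hg, hs⟩ := ((eventually_nrm f).and
            ((eventually_nrm g).and (eventually_nrm (f + g)))).exists
          rw [← hf, ← hg, ← hs]; exact norm_add_le _ _ } with
    norm_mul_le := fun f g => by
      obtain ⟨s, hf, hg, hs⟩ := ((eventually_nrm f).and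
        ((eventually_nrm g).and (eventually_nrm (f * g)))).exists
      change nrm _ ≤ nrm _ * nrm _
      rw [← hf, ← hg, ← hs]; exact norm_mul_le _ _ }

theorem norm_def (f : PreLimit hlam) : ‖f‖ = nrm f := rfl

noncomputable instance : NormedSpace ℂ (PreLimit hlam) where
  norm_smul_le c f := by
    obtain ⟨s, hf, hs⟩ := ((eventually_nrm f).and (eventually_nrm (c • f))).exists
    rw [norm_def, norm_def, ← hf, ← hs]; exact norm_smul_le c (val f s)

instance : NormedStarGroup (PreLimit hlam) where
  norm_star_le f := by
    obtain ⟨s, hf, hs⟩ := ((eventually_nrm f).and (eventually_nrm (star f))).exists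
    rw [norm_def, norm_def, ← hf, ← hs]; exact (norm_star (val f s)).le

theorem norm_mul_self_le (f : PreLimit hlam) : ‖f‖ * ‖f‖ ≤ ‖star f * f‖ := by
  obtain ⟨s, hf, hs⟩ := ((eventually_nrm f).and (eventually_nrm (star f * f))).exists
  rw [norm_def, norm_def, ← hf, ← hs]; exact (CStarRing.norm_star_mul_self (x := val f s)).ge

end PreLimit

/-- The C⋆-inductive limit `B_{[-∞}` of `B → B → B → ⋯` along `lam`. -/
def InductiveLimit (hlam : IsInjectiveSemigroup lam) : Type _ := CStarCompletion (PreLimit hlam)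

noncomputable instance (hlam : IsInjectiveSemigroup lam) :
    NonUnitalCStarAlgebra (InductiveLimit hlam) :=
  CStarCompletion.nonUnitalCStarAlgebra PreLimit.norm_mul_self_le

namespace InductiveLimit

variable (hlam : IsInjectiveSemigroup lam)

/-- The coherent function `s ↦ lam (s + t) b` (for `s ≥ -t`). -/
def orbit (t : T) (b : B) : PreLimit hlam :=
  ⟨fun s => if h : 0 ≤ (s : T) + t then lam ⟨s + t, h⟩ b else 0, by
    filter_upwards [eventually_ge_atTop ⟨max (-t) 0, le_max_right _ _⟩] with s hs r
    have h₁ : -t ≤ (s : T) := (le_max_left _ _).trans hs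
    have h₂ : 0 ≤ (s : T) + t := neg_le_iff_add_nonneg.1 h₁
    have h₃ : 0 ≤ ((s + r : {t : T // 0 ≤ t}) : T) + t := by
      rw [Nonneg.coe_add, add_right_comm]; exact add_nonneg h₂ r.2
    rw [dif_pos h₂, dif_pos h₃, ← hlam.map_add]
    congr 2
    exact Subtype.ext (by simp only [Nonneg.coe_add]; abel)⟩

theorem of_eq_of {f g : PreLimit hlam} (h : ∀ᶠ s in atTop, f.val s = g.val s) :
    CStarCompletion.of f = CStarCompletion.of g := by
  obtain ⟨s, hs, hs'⟩ := (h.and (PreLimit.eventually_nrm (f - g))).exists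
  rw [← sub_eq_zero, ← map_sub, ← norm_eq_zero, LinearIsometry.norm_map, PreLimit.norm_def, ← hs']
  change ‖f.val s - g.val s‖ = 0
  rw [hs, sub_self, norm_zero]

theorem eventually_orbit (t : T) (b : B) :
    ∀ᶠ s : {t : T // 0 ≤ t} in atTop, ∃ h : 0 ≤ (s : T) + t,
      (orbit hlam t b).val s = lam ⟨s + t, h⟩ b := by
  filter_upwards [eventually_ge_atTop ⟨max (-t) 0, le_max_right _ _⟩] with s hs
  have h₁ : -t ≤ (s : T) := (le_max_left _ _).trans hs
  have h₂ : 0 ≤ (s : T) + t := neg_le_iff_add_nonneg.1 h₁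
  exact ⟨h₂, dif_pos h₂⟩

/-- The embedding `i_t : B → B_{[t}`. -/
noncomputable def emb (t : T) : B →⋆ₙₐ[ℂ] InductiveLimit hlam where
  toFun b := CStarCompletion.of (orbit hlam t b)
  map_smul' c b := by
    refine Eq.trans (of_eq_of hlam (g := c • orbit hlam t b) ?_) (map_smul _ c _)
    filter_upwards [eventually_orbit hlam t b, eventually_orbit hlam t (c • b)] with s hb hc
    obtain ⟨h, hb⟩ := hb
    obtain ⟨_, hc⟩ := hc
    exact hc.trans ((map_smul (lam _) c b).trans (congrArg (c • ·) hb.symm))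
  map_zero' := by
    refine Eq.trans (of_eq_of hlam (g := 0) ?_) (map_zero _)
    filter_upwards [eventually_orbit hlam t 0] with s hb
    obtain ⟨h, hb⟩ := hb
    exact hb.trans (map_zero (lam _))
  map_add' a b := by
    refine Eq.trans (of_eq_of hlam (g := orbit hlam t a + orbit hlam t b) ?_) (map_add _ _ _)
    filter_upwards [eventually_orbit hlam t a, eventually_orbit hlam t b,
      eventually_orbit hlam t (a + b)] with s ha hb hc
    obtain ⟨h, ha⟩ := ha
    obtain ⟨_, hb⟩ := hb
    obtain ⟨_, hc⟩ := hc
    exact hc.trans ((map_add (lam _) a b).trans (congrArg₂ (· + ·) ha.symm hb.symm))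
  map_mul' a b := by
    refine Eq.trans (of_eq_of hlam (g := orbit hlam t a * orbit hlam t b) ?_)
      (CStarCompletion.of_mul _ _)
    filter_upwards [eventually_orbit hlam t a, eventually_orbit hlam t b,
      eventually_orbit hlam t (a * b)] with s ha hb hc
    obtain ⟨h, ha⟩ := ha
    obtain ⟨_, hb⟩ := hb
    obtain ⟨_, hc⟩ := hc
    exact hc.trans ((map_mul (lam _) a b).trans (congrArg₂ (· * ·) ha.symm hb.symm))
  map_star' b := by
    refine Eq.trans (of_eq_of hlam (g := star (orbit hlam t b)) ?_) (CStarCompletion.of_star _)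
    filter_upwards [eventually_orbit hlam t b, eventually_orbit hlam t (star b)] with s hb hc
    obtain ⟨h, hb⟩ := hb
    obtain ⟨_, hc⟩ := hc
    exact hc.trans ((map_star (lam _) b).trans (congrArg star hb.symm))

theorem emb_apply (t : T) (b : B) : emb hlam t b = CStarCompletion.of (orbit hlam t b) := rfl

theorem isInductiveLimit : IsInductiveLimit lam (emb hlam) where
  injective t := by
    refine (injective_iff_map_eq_zero _).2 fun b hb => ?_
    obtain ⟨s, ⟨h, hs⟩, hs'⟩ :=
      ((eventually_orbit hlam t b).and (PreLimit.eventually_nrm (orbit hlam t b))).exists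
    have h₁ : ‖orbit hlam t b‖ = 0 := by
      rw [← CStarCompletion.of.norm_map, ← emb_apply, hb]
      exact norm_zero
    rw [PreLimit.norm_def, ← hs', hs, norm_eq_zero] at h₁
    exact hlam.injective _ (h₁.trans (map_zero _).symm)
  compatible s t b := by
    refine of_eq_of hlam ?_
    filter_upwards [eventually_orbit hlam (s + t) b, eventually_orbit hlam s (lam t b)]
      with u h₁ h₂
    obtain ⟨h, h₁⟩ := h₁
    obtain ⟨h', h₂⟩ := h₂
    rw [h₁, h₂, ← hlam.map_add]
    congr 2
    exact Subtype.ext (add_assoc _ _ _).symm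
  dense := by
    refine (CStarCompletion.denseRange_of (D := PreLimit hlam)).mono ?_
    rintro _ ⟨f, rfl⟩
    obtain ⟨s, hs⟩ := (Subtype.property (p := (· ∈ coherent lam)) f : ∀ᶠ s in atTop, _).exists
    refine Set.mem_iUnion.2 ⟨-(s : T), f.val s, of_eq_of hlam ?_⟩
    filter_upwards [eventually_orbit hlam (-(s : T)) (f.val s), eventually_ge_atTop s]
      with u h₁ hu
    obtain ⟨h, h₁⟩ := h₁
    rw [h₁]
    refine (hs ⟨u + -s, h⟩).symm.trans (congrArg f.val (Subtype.ext ?_))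
    simp

variable {hlam}

/-- For an invariant functional `ψ` and coherent `f`, the values `ψ (f s)` are eventually constant;
this is their limit. -/
noncomputable def preState (ψ : B →L[ℂ] ℂ) (f : PreLimit hlam) : ℂ :=
  limUnder atTop fun s => ψ (f.val s)

theorem eventually_preState {ψ : B →L[ℂ] ℂ} (hinv : ∀ t b, ψ (lam t b) = ψ b)
    (f : PreLimit hlam) : ∀ᶠ s in atTop, ψ (f.val s) = preState ψ f := by
  obtain ⟨s, hs⟩ := (Subtype.property (p := (· ∈ coherent lam)) f : ∀ᶠ s in atTop, _).exists
  have h : ∀ᶠ u in atTop, ψ (f.val u) = ψ (f.val s) := by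
    filter_upwards [eventually_ge_atTop s] with u hu
    obtain ⟨r, rfl⟩ : ∃ r, u = s + r :=
      ⟨⟨u.1 - s.1, sub_nonneg.2 hu⟩, Subtype.ext (by simp)⟩
    exact (congrArg ψ (hs r)).trans (hinv _ _)
  have : preState ψ f = ψ (f.val s) :=
    Tendsto.limUnder_eq (tendsto_const_nhds.congr' (h.mono fun u hu => hu.symm))
  rw [this]
  exact h

/-- The functional induced on the algebraic inductive limit by an invariant functional `ψ`. -/
noncomputable def preStateL (ψ : B →L[ℂ] ℂ) (hinv : ∀ t b, ψ (lam t b) = ψ b) :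
    PreLimit hlam →L[ℂ] ℂ :=
  LinearMap.mkContinuous
    { toFun := preState ψ
      map_add' := fun f g => by
        obtain ⟨s, hf, hg, hs⟩ := ((eventually_preState hinv f).and
          ((eventually_preState hinv g).and (eventually_preState hinv (f + g)))).exists
        rw [← hf, ← hg, ← hs]; exact map_add ψ _ _
      map_smul' := fun c f => by
        obtain ⟨s, hf, hs⟩ :=
          ((eventually_preState hinv f).and (eventually_preState hinv (c • f))).exists
        rw [← hf, ← hs]; exact map_smul ψ c _ } ‖ψ‖ fun f => by
    obtain ⟨s, hf, hs⟩ := ((eventually_preState hinv f).and (PreLimit.eventually_nrm f)).exists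
    change ‖preState ψ f‖ ≤ ‖ψ‖ * PreLimit.nrm f
    rw [← hf, ← hs]; exact ψ.le_opNorm _

/-- The inductive limit state `ψ_{[-∞}`: the continuous extension of `ψ` to the inductive limit. -/
noncomputable def limitState (hlam : IsInjectiveSemigroup lam) (ψ : B →L[ℂ] ℂ)
    (hinv : ∀ t b, ψ (lam t b) = ψ b) : InductiveLimit hlam →L[ℂ] ℂ :=
  (preStateL (hlam := hlam) ψ hinv).extend CStarCompletion.of.toContinuousLinearMap

theorem limitState_emb (ψ : B →L[ℂ] ℂ) (hinv : ∀ t b, ψ (lam t b) = ψ b) (t : T) (b : B) :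
    limitState hlam ψ hinv (emb hlam t b) = ψ b := by
  have h : limitState hlam ψ hinv (emb hlam t b) = preState ψ (orbit hlam t b) :=
    ContinuousLinearMap.extend_eq _ (e := CStarCompletion.of.toContinuousLinearMap)
      CStarCompletion.denseRange_of CStarCompletion.isUniformInducing_of (orbit hlam t b)
  obtain ⟨s, hs, ⟨h', hs'⟩⟩ := ((eventually_preState hinv (orbit hlam t b)).and
    (eventually_orbit hlam t b)).exists
  rw [h, ← hs, hs', hinv]

end InductiveLimit

end Limit
end CStar

section GNS

variable {B : Type*} [NonUnitalCStarAlgebra B]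
variable {H : Type*} [NormedAddCommGroup H] [InnerProductSpace ℂ H] [CompleteSpace H]

/-- `(H, π, Ω)` is the GNS triple of `ψ`. -/
structure IsGNSTriple (ψ : B →L[ℂ] ℂ) (π : B →⋆ₙₐ[ℂ] (H →L[ℂ] H)) (Ω : H) : Prop where
  cyclic : Dense (Set.range fun b => π b Ω)
  inner_eq : ∀ b, ⟪Ω, π b Ω⟫_ℂ = ψ b

/-- The commutant `π(B)'`. -/
noncomputable def piCommutant (π : B →⋆ₙₐ[ℂ] (H →L[ℂ] H)) : VonNeumannAlgebra H where
  toStarSubalgebra := StarSubalgebra.centralizer ℂ (Set.range π)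
  centralizer_centralizer' := by simp

/-- The von Neumann algebra `π(B)''`. -/
noncomputable def piBicommutant (π : B →⋆ₙₐ[ℂ] (H →L[ℂ] H)) : VonNeumannAlgebra H :=
  (piCommutant π).commutant

/-- The closed subspace `K = [π(B)'Ω]`. -/
noncomputable def supportSpace (π : B →⋆ₙₐ[ℂ] (H →L[ℂ] H)) (Ω : H) : Submodule ℂ H :=
  (Submodule.span ℂ {ξ | ∃ a ∈ piCommutant π, ξ = a Ω}).topologicalClosure

instance (π : B →⋆ₙₐ[ℂ] (H →L[ℂ] H)) (Ω : H) : CompleteSpace (supportSpace π Ω) :=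
  inferInstanceAs (CompleteSpace (Submodule.topologicalClosure _))

/-- The support projection `P = [π(B)'Ω]` of the vector state of `Ω` in `π(B)''`. -/
noncomputable def supportProj (π : B →⋆ₙₐ[ℂ] (H →L[ℂ] H)) (Ω : H) : H →L[ℂ] H :=
  (supportSpace π Ω).starProjection

/-- The corner `A₀ = P π(B)'' P`, as a space of operators on `H`. -/
noncomputable def corner (π : B →⋆ₙₐ[ℂ] (H →L[ℂ] H)) (Ω : H) : Submodule ℂ (H →L[ℂ] H) where
  carrier := {x | ∃ X ∈ piBicommutant π, x = supportProj π Ω * X * supportProj π Ω}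
  add_mem' := by
    rintro _ _ ⟨X, hX, rfl⟩ ⟨Y, hY, rfl⟩
    exact ⟨X + Y, add_mem hX hY, by simp [mul_add, add_mul]⟩
  zero_mem' := ⟨0, zero_mem _, by simp⟩
  smul_mem' := by
    rintro c _ ⟨X, hX, rfl⟩
    exact ⟨c • X, (piBicommutant π).toStarSubalgebra.smul_mem hX c, by simp⟩

theorem mem_piCommutant {π : B →⋆ₙₐ[ℂ] (H →L[ℂ] H)} {a : H →L[ℂ] H} :
    a ∈ piCommutant π ↔ ∀ b, π b * a = a * π b := by
  change a ∈ StarSubalgebra.centralizer ℂ (Set.range π) ↔ _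
  rw [StarSubalgebra.mem_centralizer_iff]
  constructor
  · intro h b
    exact (h _ ⟨b, rfl⟩).1
  · rintro h _ ⟨b, rfl⟩
    exact ⟨h b, by rw [← map_star]; exact h (star b)⟩

theorem map_supportSpace_le {π : B →⋆ₙₐ[ℂ] (H →L[ℂ] H)} {Ω : H} {a : H →L[ℂ] H}
    (ha : a ∈ piCommutant π) {ξ : H} (hξ : ξ ∈ supportSpace π Ω) : a ξ ∈ supportSpace π Ω := by
  have h : Set.MapsTo a (Submodule.span ℂ {ξ | ∃ a ∈ piCommutant π, ξ = a Ω})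
      (Submodule.span ℂ {ξ | ∃ a ∈ piCommutant π, ξ = a Ω}) := by
    intro η hη
    induction hη using Submodule.span_induction with
    | mem x hx =>
      obtain ⟨c, hc, rfl⟩ := hx
      exact Submodule.subset_span ⟨a * c, mul_mem ha hc, rfl⟩
    | zero => simp
    | add x y _ _ hx hy => simpa using add_mem hx hy
    | smul c x _ hx => simpa using Submodule.smul_mem _ c hx
  exact map_mem_closure a.continuous hξ h

theorem supportProj_mem (π : B →⋆ₙₐ[ℂ] (H →L[ℂ] H)) (Ω : H) :
    supportProj π Ω ∈ piBicommutant π := by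
  rw [piBicommutant, VonNeumannAlgebra.mem_commutant_iff]
  intro a ha
  ext ξ
  symm
  refine Submodule.eq_starProjection_of_mem_of_inner_eq_zero
    (map_supportSpace_le ha (Submodule.starProjection_apply_mem _ ξ)) fun w hw => ?_
  change ⟪a ξ - a ((supportSpace π Ω).starProjection ξ), w⟫_ℂ = 0
  rw [← map_sub, ← ContinuousLinearMap.adjoint_inner_right, ← ContinuousLinearMap.star_eq_adjoint]
  exact (Submodule.mem_orthogonal' _ _).1 (Submodule.sub_starProjection_mem_orthogonal ξ) _
    (map_supportSpace_le (star_mem ha) hw)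

theorem corner_le (π : B →⋆ₙₐ[ℂ] (H →L[ℂ] H)) (Ω : H) {x : H →L[ℂ] H} (hx : x ∈ corner π Ω) :
    x ∈ (piBicommutant π).toStarSubalgebra := by
  obtain ⟨X, hX, rfl⟩ := hx
  exact mul_mem (mul_mem (supportProj_mem π Ω) hX) (supportProj_mem π Ω)

/-- Normality of a linear map on a von Neumann algebra: on bounded sets it is continuous for the
weak operator topologies (which agree with the σ-weak topologies there). -/
def IsNormalMap (M : VonNeumannAlgebra H) {S : Submodule ℂ (H →L[ℂ] H)}
    (Φ : M.toStarSubalgebra →ₗ[ℂ] S) : Prop :=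
  ∀ (l : Filter M.toStarSubalgebra) (X : M.toStarSubalgebra),
    (∃ r : ℝ, ∀ᶠ Y : M.toStarSubalgebra in l, ‖(Y : H →L[ℂ] H)‖ ≤ r) →
    (∀ ξ η : H, Tendsto (fun Y : M.toStarSubalgebra => ⟪ξ, (Y : H →L[ℂ] H) η⟫_ℂ) l
      (𝓝 ⟪ξ, (X : H →L[ℂ] H) η⟫_ℂ)) →
    ∀ ξ η : H, Tendsto (fun Y => ⟪ξ, (Φ Y : H →L[ℂ] H) η⟫_ℂ) l (𝓝 ⟪ξ, (Φ X : H →L[ℂ] H) η⟫_ℂ)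

/-- `Φ` is the normal extension to `π(B)''` of the map `π(b) ↦ P π(α b) P`. -/
def IsCompressedExtension (π : B →⋆ₙₐ[ℂ] (H →L[ℂ] H)) (Ω : H) (α : B →⋆ₙₐ[ℂ] B)
    (Φ : (piBicommutant π).toStarSubalgebra →ₗ[ℂ] corner π Ω) : Prop :=
  IsNormalMap (piBicommutant π) Φ ∧
    ∀ (b : B) (hb : π b ∈ (piBicommutant π).toStarSubalgebra),
      (Φ ⟨π b, hb⟩ : H →L[ℂ] H) = supportProj π Ω * π (α b) * supportProj π Ω

open Classical in
/-- The map `X ↦ P α(X) P` from `π(B)''` to the corner `A₀`, for an endomorphism `α` of `B` that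
preserves the state. It is the (unique) normal extension of `π(b) ↦ P π(α b) P`; if `α` itself
extends to a normal endomorphism of `π(B)''`, it is literally `X ↦ P α(X) P`. -/
noncomputable def compressedExtension (π : B →⋆ₙₐ[ℂ] (H →L[ℂ] H)) (Ω : H) (α : B →⋆ₙₐ[ℂ] B) :
    (piBicommutant π).toStarSubalgebra →ₗ[ℂ] corner π Ω :=
  if h : ∃ Φ, IsCompressedExtension π Ω α Φ then h.choose else 0

/-- The compressed map `τ(x) = P α(P x P) P` on the corner `A₀` (where `P x P = x`). -/
noncomputable def compress (π : B →⋆ₙₐ[ℂ] (H →L[ℂ] H)) (Ω : H) (α : B →⋆ₙₐ[ℂ] B)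
    (x : corner π Ω) : corner π Ω :=
  compressedExtension π Ω α ⟨x, corner_le π Ω x.2⟩

/-- The vector state `φ₀(x) = ⟨Ω, x Ω⟩`. -/
noncomputable def vectorState (Ω : H) (x : H →L[ℂ] H) : ℂ := ⟪Ω, x Ω⟫_ℂ

/-- The weak Kolmogorov property of `(A₀, τ, φ₀)`: there are contractions `c t` in `A₀`
such that, for all `s ≥ 0` and `x, y` in `A₀`, one has
`φ₀(τ_t(x) c_{s+t}⋆ c_{s+t} τ_t(y)) → φ₀(x) φ₀(y)` as `t → ∞`. -/
def IsWeaklyKolmogorov {T : Type*} [AddCommGroup T] [LinearOrder T] [IsOrderedAddMonoid T]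
    (π : B →⋆ₙₐ[ℂ] (H →L[ℂ] H)) (Ω : H) (lam : {t : T // 0 ≤ t} → (B →⋆ₙₐ[ℂ] B)) : Prop :=
  ∃ c : {t : T // 0 ≤ t} → corner π Ω, (∀ t, ‖(c t : H →L[ℂ] H)‖ ≤ 1) ∧
    ∀ (s : {t : T // 0 ≤ t}) (x y : corner π Ω),
      Tendsto (fun t => vectorState Ω
          ((compress π Ω (lam t) x : H →L[ℂ] H) * star (c (s + t) : H →L[ℂ] H) *
            (c (s + t) : H →L[ℂ] H) * (compress π Ω (lam t) y : H →L[ℂ] H)))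
        atTop (𝓝 (vectorState Ω x * vectorState Ω y))

end GNS

end WeakKolmogorov

namespace WeakKolmogorov

set_option linter.unusedSectionVars false

-- Invariance of the state gives isometries V_t on H with V_t π(b)Ω = π(λ_t b)Ω. The compressed
-- dynamics satisfies τ_t(x)Ω = P V_t xΩ, and τ_t(x)* = τ_t(x*), so the correlation in (WK) equals
-- ⟨c V_t x*Ω, c V_t yΩ⟩ with c = c_{s+t} (`vectorState_compress`). Thus (WK) asks that c_{s+t} V_t
-- behave asymptotically like the projection onto Ω.
--
-- (WK) implies purity: let ω be a positive functional below the limit state. On the subalgebra at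
-- time -u it has a density a_u in π(B)' (`IsGNSTriple.exists_commutant_of_le`). Passing from time
-- -s to -(s+t) replaces π(b)Ω by V_t π(b)Ω. By (WK), c*cΩ is close to Ω and c V_t π(b)Ω is close to
-- ψ(b)cΩ. Since c commutes with a_{s+t}, ω(i_{-s}(b)) is asymptotically ψ(b)⟨cΩ, a_{s+t} cΩ⟩. The
-- second factor does not depend on b, so ω is a multiple of the limit state.
--
-- Purity implies (WK): the GNS representation ρ of the limit state, with cyclic vector ξ, is
-- irreducible, so the projection onto ξ lies in its bicommutant. By Kaplansky density it is a
-- strong limit of contractions from the increasing union (`exists_filter_tendsto_rankOne`).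
-- Compressing these by the support projections, which decrease with the time parameter and hence
-- converge strongly, produces contractions in the corner that do what is required on finitely many
-- vectors (`eventually_exists_contraction`). Separability of K and the Archimedean property reduce
-- (WK) to countably many conditions, and a diagonal choice meets them all.
--
-- An endomorphism λ_t need not extend normally to π(B)'', but its compression does
-- (`exists_isCompressedExtension`), and uniquely so, again by Kaplansky density
-- (`IsNormalMap.eq_zero`). Both uses of Kaplansky density rest on the strong continuity of the
-- bounded transform 2b/(1+b²).

universe u

/-! ### Approximate units and the GNS construction without a unit. -/

section PositiveFunctionals

variable {B : Type*} [NonUnitalCStarAlgebra B]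

/-- A positive functional as a positive linear map, for the spectral order. -/
theorem exists_positiveLinearMap [PartialOrder B] [StarOrderedRing B] {ω : B →L[ℂ] ℂ}
    (hω : ∀ b, 0 ≤ ω (star b * b)) : ∃ f : B →ₚ[ℂ] ℂ, ∀ b, f b = ω b :=
  ⟨PositiveLinearMap.mk₀ (ω : B →ₗ[ℂ] ℂ) fun x hx => by
    obtain ⟨b, rfl⟩ := CStarAlgebra.nonneg_iff_eq_star_mul_self.1 hx
    exact hω b, fun _ => rfl⟩

/-- A C⋆-algebra has a contractive approximate unit. -/
theorem exists_approximateUnit (B : Type*) [NonUnitalCStarAlgebra B] :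
    ∃ l : Filter B, l.NeBot ∧ (∀ᶠ e in l, ‖e‖ ≤ 1) ∧ ∀ b : B, Tendsto (fun e => e * b) l (𝓝 b) := by
  let _ := CStarAlgebra.spectralOrder B
  have := CStarAlgebra.spectralOrderedRing B
  have h := CStarAlgebra.increasingApproximateUnit B
  exact ⟨_, h.neBot, h.eventually_norm, h.tendsto_mul_right⟩

/-- The GNS construction for a positive functional on a C⋆-algebra. -/
theorem exists_isGNSTriple {B : Type u} [NonUnitalCStarAlgebra B] {ω : B →L[ℂ] ℂ}
    (hω : ∀ b, 0 ≤ ω (star b * b)) :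
    ∃ (E : Type u) (_ : NormedAddCommGroup E) (_ : InnerProductSpace ℂ E) (_ : CompleteSpace E)
      (ρ : B →⋆ₙₐ[ℂ] (E →L[ℂ] E)) (ξ : E), IsGNSTriple ω ρ ξ := by
  let _ := CStarAlgebra.spectralOrder B
  have := CStarAlgebra.spectralOrderedRing B
  obtain ⟨f, hf⟩ := exists_positiveLinearMap hω
  obtain ⟨l, hl, hl₁, hl₂⟩ := exists_approximateUnit B
  -- There is no class of a unit to serve as cyclic vector. Cauchy–Schwarz for ω(ea) = ⟨e*, a⟩, with
  -- e in the approximate unit, shows that ω is bounded for the GNS seminorm, and Riesz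
  -- representation then supplies ξ.
  have hbd : ∀ a : f.PreGNS, ‖ω (f.ofPreGNS a)‖ ≤ √‖ω‖ * ‖a‖ := by
    intro a
    refine le_of_tendsto ((ω.continuous.tendsto _).comp (hl₂ (f.ofPreGNS a))).norm ?_
    filter_upwards [hl₁] with e he
    have h₁ : ω (e * f.ofPreGNS a) = ⟪f.toPreGNS (star e), a⟫_ℂ := by
      rw [f.preGNS_inner_def, f.ofPreGNS_toPreGNS, star_star, hf]
    have h₂ : ‖f.toPreGNS (star e)‖ ≤ √‖ω‖ := by
      rw [f.preGNS_norm_def]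
      refine Real.sqrt_le_sqrt ((Complex.re_le_norm _).trans ?_)
      rw [f.ofPreGNS_toPreGNS, star_star, hf]
      refine (ω.le_opNorm _).trans (mul_le_of_le_one_right (norm_nonneg _) ?_)
      rw [CStarRing.norm_self_mul_star]
      exact mul_le_one₀ he (norm_nonneg _) he
    simp only [Function.comp_apply]
    rw [h₁]
    exact (norm_inner_le_norm _ _).trans (mul_le_mul_of_nonneg_right h₂ (norm_nonneg _))
  let j : f.PreGNS →ₗ[ℂ] f.GNS := (UniformSpace.Completion.toComplₗᵢ (𝕜 := ℂ)).toLinearMap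
  have hj : DenseRange j := UniformSpace.Completion.denseRange_coe
  let k : f.PreGNS →ₗ[ℂ] ℂ := (ω : B →ₗ[ℂ] ℂ) ∘ₗ f.ofPreGNS.toLinearMap
  have hk : ∀ a, (k.extendOfNorm j) (j a) = ω (f.ofPreGNS a) := fun a =>
    LinearMap.extendOfNorm_eq hj ⟨√‖ω‖, fun a => by
      simpa [j, k] using hbd a⟩ a
  set ξ : f.GNS := (InnerProductSpace.toDual ℂ f.GNS).symm (k.extendOfNorm j) with hξ
  have h₁ : ∀ a : f.PreGNS, ⟪ξ, j a⟫_ℂ = ω (f.ofPreGNS a) := fun a => by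
    rw [hξ, InnerProductSpace.toDual_symm_apply, hk]
  have hρ : ∀ (b : B) (a : f.PreGNS), f.gnsNonUnitalStarAlgHom b (j a) =
      j (f.toPreGNS (b * f.ofPreGNS a)) := fun b a =>
    f.gnsNonUnitalStarAlgHom_apply_coe
  have h₂ : ∀ b : B, f.gnsNonUnitalStarAlgHom b ξ = j (f.toPreGNS b) := by
    intro b
    refine hj.eq_of_inner_left ℂ fun c => ?_
    have h₃ : ⟪f.gnsNonUnitalStarAlgHom b ξ, j c⟫_ℂ = ⟪ξ, f.gnsNonUnitalStarAlgHom (star b) (j c)⟫_ℂ := by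
      rw [map_star, ContinuousLinearMap.star_eq_adjoint, ContinuousLinearMap.adjoint_inner_right]
    rw [h₃, hρ, h₁, f.ofPreGNS_toPreGNS, ← hf]
    exact (UniformSpace.Completion.inner_coe (𝕜 := ℂ) (f.toPreGNS b) c).symm
  refine ⟨f.GNS, inferInstance, inferInstance, inferInstance, f.gnsNonUnitalStarAlgHom, ξ, ?_, ?_⟩
  · have : (fun b => f.gnsNonUnitalStarAlgHom b ξ) = fun b => j (f.toPreGNS b) := funext h₂
    rw [this]
    exact hj.comp f.toPreGNS.surjective.denseRange (UniformSpace.Completion.continuous_coe _)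
  · intro b
    rw [h₂, h₁, f.ofPreGNS_toPreGNS]

end PositiveFunctionals

/-! ### Elementary properties of GNS triples. -/

section Triple

variable {B : Type*} [NonUnitalCStarAlgebra B]
variable {H : Type*} [NormedAddCommGroup H] [InnerProductSpace ℂ H] [CompleteSpace H]
variable {E : Type*} [NormedAddCommGroup E] [InnerProductSpace ℂ E] [CompleteSpace E]

theorem inner_map_star (π : B →⋆ₙₐ[ℂ] (H →L[ℂ] H)) (b : B) (ξ η : H) :
    ⟪ξ, π (star b) η⟫_ℂ = ⟪π b ξ, η⟫_ℂ := by
  rw [map_star, ContinuousLinearMap.star_eq_adjoint, ContinuousLinearMap.adjoint_inner_right]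

theorem map_mul_apply (π : B →⋆ₙₐ[ℂ] (H →L[ℂ] H)) (a b : B) (ξ : H) :
    π (a * b) ξ = π a (π b ξ) := by
  rw [map_mul]
  rfl

theorem inner_star_apply (a : H →L[ℂ] H) (ξ η : H) : ⟪ξ, star a η⟫_ℂ = ⟪a ξ, η⟫_ℂ := by
  rw [ContinuousLinearMap.star_eq_adjoint, ContinuousLinearMap.adjoint_inner_right]

theorem norm_map_apply_le (π : B →⋆ₙₐ[ℂ] (H →L[ℂ] H)) (b : B) (ξ : H) :
    ‖π b ξ‖ ≤ ‖b‖ * ‖ξ‖ :=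
  (π b).le_of_opNorm_le (NonUnitalStarAlgHom.norm_apply_le π b) ξ

variable {ψ : B →L[ℂ] ℂ} {π : B →⋆ₙₐ[ℂ] (H →L[ℂ] H)} {Ω : H}

/-- The map `b ↦ π(b)Ω`. -/
noncomputable def orbitMap (π : B →⋆ₙₐ[ℂ] (H →L[ℂ] H)) (Ω : H) : B →ₗ[ℂ] H where
  toFun b := π b Ω
  map_add' a b := by simp
  map_smul' c b := by simp

namespace IsGNSTriple

theorem inner_apply (h : IsGNSTriple ψ π Ω) (a b : B) :
    ⟪π a Ω, π b Ω⟫_ℂ = ψ (star a * b) := by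
  rw [← inner_map_star, ← h.inner_eq, map_mul]
  rfl

theorem denseRange (h : IsGNSTriple ψ π Ω) : DenseRange (orbitMap π Ω) := h.cyclic

theorem ext_operator (h : IsGNSTriple ψ π Ω) {S T : H →L[ℂ] E}
    (hST : ∀ b, S (π b Ω) = T (π b Ω)) : S = T :=
  ContinuousLinearMap.coeFn_injective
    (h.denseRange.equalizer S.continuous T.continuous (funext hST))

theorem eq_of_inner (h : IsGNSTriple ψ π Ω) {ξ η : H}
    (hb : ∀ b, ⟪ξ, π b Ω⟫_ℂ = ⟪η, π b Ω⟫_ℂ) : ξ = η :=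
  h.denseRange.eq_of_inner_left ℂ hb

/-- Nondegeneracy: such a ξ is orthogonal to every π(b)Ω. This is the hypothesis `hnd` of the
density theorems below. -/
theorem eq_zero_of_forall_apply_eq_zero (h : IsGNSTriple ψ π Ω) {ξ : H} (hξ : ∀ b, π b ξ = 0) :
    ξ = 0 :=
  h.eq_of_inner fun b => by
    rw [inner_zero_left, ← star_star b, inner_map_star, hξ, inner_zero_left]

/-- In a GNS representation the approximate unit converges strongly to the identity. -/
theorem tendsto_approximateUnit (h : IsGNSTriple ψ π Ω) {l : Filter B}
    (hl₁ : ∀ᶠ e in l, ‖e‖ ≤ 1) (hl₂ : ∀ b : B, Tendsto (fun e => e * b) l (𝓝 b)) (ξ : H) :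
    Tendsto (fun e => π e ξ) l (𝓝 ξ) := by
  rw [Metric.tendsto_nhds]
  intro ε hε
  obtain ⟨b, hb⟩ := Metric.denseRange_iff.1 h.denseRange ξ (ε / 4) (by positivity)
  have h₁ : Tendsto (fun e => π e (π b Ω)) l (𝓝 (π b Ω)) := by
    have : Tendsto (fun e => orbitMap π Ω (e * b)) l (𝓝 (orbitMap π Ω b)) := by
      have hc : Continuous (orbitMap π Ω) :=
        AddMonoidHomClass.continuous_of_bound (orbitMap π Ω) ‖Ω‖ fun b => by
          rw [mul_comm]; exact norm_map_apply_le π b Ω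
      exact (hc.tendsto b).comp (hl₂ b)
    simpa [orbitMap, map_mul] using this
  filter_upwards [hl₁, Metric.tendsto_nhds.1 h₁ (ε / 4) (by positivity)] with e he he'
  change dist ξ (π b Ω) < _ at hb
  rw [dist_eq_norm] at *
  have h₂ : ‖π e (ξ - π b Ω)‖ ≤ ‖ξ - π b Ω‖ :=
    (norm_map_apply_le π e _).trans (mul_le_of_le_one_left (norm_nonneg _) he)
  have h₃ : π e ξ - ξ = π e (ξ - π b Ω) + (π e (π b Ω) - π b Ω) - (ξ - π b Ω) := by
    rw [map_sub]; abel
  rw [h₃]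
  calc _ ≤ ‖π e (ξ - π b Ω)‖ + ‖π e (π b Ω) - π b Ω‖ + ‖ξ - π b Ω‖ :=
        (norm_sub_le _ _).trans (add_le_add_left (norm_add_le _ _) _)
    _ < ε := by linarith

/-- One inequality is Cauchy–Schwarz. For the other, ψ(e) tends to ‖Ω‖² along an approximate unit,
because π(e) tends strongly to the identity. -/
theorem norm_sq (h : IsGNSTriple ψ π Ω) : ‖Ω‖ ^ 2 = ‖ψ‖ := by
  refine le_antisymm ?_ ?_
  · obtain ⟨l, hl, hl₁, hl₂⟩ := exists_approximateUnit B
    have h₁ : Tendsto (fun e => ‖⟪Ω, π e Ω⟫_ℂ‖) l (𝓝 ‖⟪Ω, Ω⟫_ℂ‖) :=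
      (tendsto_const_nhds.inner (h.tendsto_approximateUnit hl₁ hl₂ Ω)).norm
    have h₂ : ‖⟪Ω, Ω⟫_ℂ‖ = ‖Ω‖ ^ 2 := by
      rw [inner_self_eq_norm_sq_to_K]; simp
    rw [← h₂]
    refine le_of_tendsto h₁ ?_
    filter_upwards [hl₁] with e he
    rw [h.inner_eq]
    exact (ψ.le_opNorm e).trans (mul_le_of_le_one_right (norm_nonneg _) he)
  · refine ψ.opNorm_le_bound (by positivity) fun b => ?_
    rw [← h.inner_eq, pow_two, mul_assoc, mul_comm ‖Ω‖ ‖b‖]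
    exact (norm_inner_le_norm _ _).trans
      (mul_le_mul_of_nonneg_left (norm_map_apply_le π b Ω) (norm_nonneg _))

theorem norm_eq_one (h : IsGNSTriple ψ π Ω) (hψ : ψ ∈ stateSpace B) : ‖Ω‖ = 1 := by
  have := h.norm_sq
  rw [hψ.2] at this
  exact (pow_eq_one_iff_of_nonneg (norm_nonneg _) two_ne_zero).1 this

end IsGNSTriple

end Triple

/-! ### The support projection and its corner. -/

section SupportProjection

variable {B : Type*} [NonUnitalCStarAlgebra B]
variable {H : Type*} [NormedAddCommGroup H] [InnerProductSpace ℂ H] [CompleteSpace H]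
variable {π : B →⋆ₙₐ[ℂ] (H →L[ℂ] H)} {Ω : H}

theorem apply_mem_supportSpace {a : H →L[ℂ] H} (ha : a ∈ piCommutant π) : a Ω ∈ supportSpace π Ω :=
  Submodule.le_topologicalClosure _ (Submodule.subset_span ⟨a, ha, rfl⟩)

theorem mem_supportSpace_self : Ω ∈ supportSpace π Ω :=
  apply_mem_supportSpace (one_mem (piCommutant π))

theorem supportSpace_le {S : Submodule ℂ H} (hS : IsClosed (S : Set H))
    (h : ∀ a ∈ piCommutant π, a Ω ∈ S) : supportSpace π Ω ≤ S :=
  Submodule.topologicalClosure_minimal _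
    (Submodule.span_le.2 (by rintro _ ⟨a, ha, rfl⟩; exact h a ha)) hS

theorem supportProj_apply_mem (x : H) : supportProj π Ω x ∈ supportSpace π Ω :=
  Submodule.starProjection_apply_mem _ x

theorem supportProj_eq_self {x : H} (hx : x ∈ supportSpace π Ω) : supportProj π Ω x = x :=
  Submodule.starProjection_eq_self_iff.2 hx

theorem supportProj_self : supportProj π Ω Ω = Ω := supportProj_eq_self mem_supportSpace_self

theorem supportProj_mul_self : supportProj π Ω * supportProj π Ω = supportProj π Ω := by
  ext x
  exact supportProj_eq_self (supportProj_apply_mem x)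

theorem star_supportProj : star (supportProj π Ω) = supportProj π Ω :=
  (isSelfAdjoint_starProjection _)

theorem inner_supportProj (x y : H) : ⟪x, supportProj π Ω y⟫_ℂ = ⟪supportProj π Ω x, y⟫_ℂ := by
  rw [← inner_star_apply, star_supportProj]

theorem norm_supportProj_apply_le (x : H) : ‖supportProj π Ω x‖ ≤ ‖x‖ :=
  Submodule.norm_starProjection_apply_le _ x

theorem norm_supportProj_le : ‖supportProj π Ω‖ ≤ 1 :=
  ContinuousLinearMap.opNorm_le_bound _ zero_le_one fun x => by
    rw [one_mul]; exact norm_supportProj_apply_le x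

theorem mem_piCommutant_iff_apply {a : H →L[ℂ] H} :
    a ∈ piCommutant π ↔ ∀ b x, π b (a x) = a (π b x) :=
  mem_piCommutant.trans
    ⟨fun h b x => congrArg (· x) (h b), fun h b => ContinuousLinearMap.ext (h b)⟩

theorem mem_piBicommutant {X : H →L[ℂ] H} :
    X ∈ piBicommutant π ↔ ∀ a ∈ piCommutant π, a * X = X * a :=
  VonNeumannAlgebra.mem_commutant_iff

theorem map_mem_piBicommutant (b : B) : π b ∈ piBicommutant π :=
  mem_piBicommutant.2 fun _ ha => (mem_piCommutant.1 ha b).symm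

theorem commute_supportProj {a : H →L[ℂ] H} (ha : a ∈ piCommutant π) (x : H) :
    a (supportProj π Ω x) = supportProj π Ω (a x) :=
  congrArg (· x) (mem_piBicommutant.1 (supportProj_mem π Ω) a ha)

theorem mem_corner_iff {x : H →L[ℂ] H} : x ∈ corner π Ω ↔
    x ∈ piBicommutant π ∧ supportProj π Ω * x = x ∧ x * supportProj π Ω = x := by
  constructor
  · intro hx
    refine ⟨corner_le π Ω hx, ?_⟩
    obtain ⟨X, -, rfl⟩ := hx
    refine ⟨?_, ?_⟩
    · rw [← mul_assoc, ← mul_assoc, supportProj_mul_self]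
    · rw [mul_assoc, supportProj_mul_self]
  · rintro ⟨h, h₁, h₂⟩
    exact ⟨x, h, by rw [h₁, h₂]⟩

theorem star_mem_corner {x : H →L[ℂ] H} (hx : x ∈ corner π Ω) : star x ∈ corner π Ω := by
  obtain ⟨h, h₁, h₂⟩ := mem_corner_iff.1 hx
  refine mem_corner_iff.2 ⟨star_mem h, ?_, ?_⟩
  · rw [← congrArg star h₂, star_mul, star_supportProj, ← mul_assoc, supportProj_mul_self]
  · rw [← congrArg star h₁, star_mul, star_supportProj, mul_assoc, supportProj_mul_self]

theorem compress_mem_corner (b : B) :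
    supportProj π Ω * π b * supportProj π Ω ∈ corner π Ω :=
  ⟨π b, map_mem_piBicommutant b, rfl⟩

theorem supportProj_mem_corner : supportProj π Ω ∈ corner π Ω :=
  mem_corner_iff.2 ⟨supportProj_mem π Ω, supportProj_mul_self, supportProj_mul_self⟩

theorem piCommutant_le_comp {C : Type*} [NonUnitalCStarAlgebra C] (α : C →⋆ₙₐ[ℂ] B)
    {a : H →L[ℂ] H} (ha : a ∈ piCommutant π) : a ∈ piCommutant (π.comp α) :=
  mem_piCommutant.2 fun b => mem_piCommutant.1 ha (α b)

/-- Restricting the representation to the range of α enlarges the commutant. Consequently the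
support spaces of an increasing family of subalgebras decrease. -/
theorem supportSpace_le_comp {C : Type*} [NonUnitalCStarAlgebra C] (α : C →⋆ₙₐ[ℂ] B) :
    supportSpace π Ω ≤ supportSpace (π.comp α) Ω :=
  supportSpace_le (Submodule.isClosed_topologicalClosure _)
    fun _ ha => apply_mem_supportSpace (piCommutant_le_comp α ha)

end SupportProjection

/-! ### Isometries intertwining two representations. -/

section Intertwiner

variable {B : Type*} [NonUnitalCStarAlgebra B]
variable {H : Type*} [NormedAddCommGroup H] [InnerProductSpace ℂ H] [CompleteSpace H]
variable {E : Type*} [NormedAddCommGroup E] [InnerProductSpace ℂ E] [CompleteSpace E]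

open ContinuousLinearMap (adjoint)

/-- `U` is an isometry that intertwines the representations `π` and `ρ` and maps `Ω` to `ξ`. -/
structure IsIntertwiningIsometry (π : B →⋆ₙₐ[ℂ] (H →L[ℂ] H)) (Ω : H)
    (ρ : B →⋆ₙₐ[ℂ] (E →L[ℂ] E)) (ξ : E) (U : H →L[ℂ] E) : Prop where
  norm_map : ∀ x, ‖U x‖ = ‖x‖
  map_vec : U Ω = ξ
  comm : ∀ b x, U (π b x) = ρ b (U x)

variable {ψ : B →L[ℂ] ℂ} {π : B →⋆ₙₐ[ℂ] (H →L[ℂ] H)} {Ω : H}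
  {ρ : B →⋆ₙₐ[ℂ] (E →L[ℂ] E)} {ξ : E} {U : H →L[ℂ] E}

theorem adjoint_comm_of_comm (h : ∀ b x, U (π b x) = ρ b (U x)) (b : B) (y : E) :
    adjoint U (ρ b y) = π b (adjoint U y) :=
  ext_inner_right ℂ fun x => by
    rw [ContinuousLinearMap.adjoint_inner_left, ← inner_map_star, ← h,
      ← ContinuousLinearMap.adjoint_inner_left, inner_map_star]

/-- The uniqueness argument for the GNS construction. Since ρ may be degenerate, UΩ = ξ is not
automatic; it follows from U*ξ = Ω and the equality of norms. It serves both to implement λ_t on H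
and to embed H in the GNS space of the limit state. -/
theorem IsGNSTriple.exists_isIntertwiningIsometry (h : IsGNSTriple ψ π Ω)
    (hξ : ∀ b, ⟪ξ, ρ b ξ⟫_ℂ = ψ b) (hn : ‖ξ‖ = ‖Ω‖) :
    ∃ U, IsIntertwiningIsometry π Ω ρ ξ U := by
  have hnorm : ∀ b, ‖orbitMap ρ ξ b‖ = ‖orbitMap π Ω b‖ := fun b => by
    have : ⟪ρ b ξ, ρ b ξ⟫_ℂ = ⟪π b Ω, π b Ω⟫_ℂ := by
      rw [h.inner_apply, ← inner_map_star, ← hξ, map_mul]; rfl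
    rw [inner_self_eq_norm_sq_to_K, inner_self_eq_norm_sq_to_K] at this
    exact (sq_eq_sq₀ (norm_nonneg _) (norm_nonneg _)).1 (by exact_mod_cast this)
  set U := (orbitMap ρ ξ).extendOfNorm (orbitMap π Ω)
  have hU : ∀ b, U (π b Ω) = ρ b ξ := fun b =>
    LinearMap.extendOfNorm_eq h.denseRange ⟨1, fun b => by rw [hnorm, one_mul]⟩ b
  have hUn : ∀ x, ‖U x‖ = ‖x‖ := fun x => by
    refine h.denseRange.induction_on (p := fun x => ‖U x‖ = ‖x‖) x
      (isClosed_eq (by fun_prop) (by fun_prop)) fun b => ?_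
    exact (congrArg norm (hU b)).trans (hnorm b)
  refine ⟨U, hUn, ?_, fun b x => ?_⟩
  · have h₁ : adjoint U ξ = Ω := h.eq_of_inner fun b => by
      rw [ContinuousLinearMap.adjoint_inner_left, hU, hξ, h.inner_eq]
    have h₂ : ⟪U Ω, ξ⟫_ℂ = ⟪Ω, Ω⟫_ℂ := by
      rw [← ContinuousLinearMap.adjoint_inner_right, h₁]
    rw [← sub_eq_zero, ← norm_eq_zero, ← sq_eq_zero_iff, @norm_sub_sq ℂ, h₂, hUn, hn,
      inner_self_eq_norm_sq]
    ring
  · have : U ∘L π b = ρ b ∘L U := h.ext_operator fun c => by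
      change U (π b (π c Ω)) = ρ b (U (π c Ω))
      rw [hU, ← map_mul_apply, hU, map_mul_apply]
    exact congrArg (· x) this

namespace IsIntertwiningIsometry

theorem inner_map_map (h : IsIntertwiningIsometry π Ω ρ ξ U) (x y : H) :
    ⟪U x, U y⟫_ℂ = ⟪x, y⟫_ℂ :=
  (⟨U.toLinearMap, h.norm_map⟩ : H →ₗᵢ[ℂ] E).inner_map_map x y

theorem adjoint_apply_map (h : IsIntertwiningIsometry π Ω ρ ξ U) (x : H) :
    adjoint U (U x) = x :=
  ext_inner_right ℂ fun y => by
    rw [ContinuousLinearMap.adjoint_inner_left, h.inner_map_map]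

theorem adjoint_vec (h : IsIntertwiningIsometry π Ω ρ ξ U) : adjoint U ξ = Ω := by
  rw [← h.map_vec, h.adjoint_apply_map]

theorem apply_vec (h : IsIntertwiningIsometry π Ω ρ ξ U) (b : B) : U (π b Ω) = ρ b ξ := by
  rw [h.comm, h.map_vec]

theorem adjoint_comm (h : IsIntertwiningIsometry π Ω ρ ξ U) (b : B) (y : E) :
    adjoint U (ρ b y) = π b (adjoint U y) :=
  adjoint_comm_of_comm h.comm b y

theorem compress_mem (h : IsIntertwiningIsometry π Ω ρ ξ U) {a : E →L[ℂ] E}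
    (ha : a ∈ piCommutant ρ) : adjoint U ∘L a ∘L U ∈ piCommutant π :=
  mem_piCommutant_iff_apply.2 fun b x => by
    simp only [ContinuousLinearMap.comp_apply]
    rw [h.comm, ← h.adjoint_comm, mem_piCommutant_iff_apply.1 ha]

theorem conj_mem (h : IsIntertwiningIsometry π Ω ρ ξ U) {a : H →L[ℂ] H}
    (ha : a ∈ piCommutant π) : U ∘L a ∘L adjoint U ∈ piCommutant ρ :=
  mem_piCommutant_iff_apply.2 fun b x => by
    simp only [ContinuousLinearMap.comp_apply]
    rw [h.adjoint_comm, ← h.comm, mem_piCommutant_iff_apply.1 ha]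

/-- An intertwining isometry intertwines the support projections. -/
theorem map_supportProj (h : IsIntertwiningIsometry π Ω ρ ξ U) (x : H) :
    U (supportProj π Ω x) = supportProj ρ ξ (U x) := by
  have h₁ : supportSpace π Ω ≤ (supportSpace ρ ξ).comap U.toLinearMap := by
    refine supportSpace_le ?_ fun a ha => ?_
    · exact (Submodule.isClosed_topologicalClosure _).preimage U.continuous
    · have := apply_mem_supportSpace (Ω := ξ) (h.conj_mem ha)
      change U (a (adjoint U ξ)) ∈ _ at this
      rwa [h.adjoint_vec] at this
  refine (Submodule.eq_starProjection_of_mem_of_inner_eq_zero (K := supportSpace ρ ξ)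
    (h₁ (supportProj_apply_mem x)) fun w hw => ?_).symm
  -- The inner product of U(x - Px) with aξ is that of x - Px with (U*aU)Ω, and U*aU lies in the
  -- commutant of π.
  have h₂ : supportSpace ρ ξ ≤ (ℂ ∙ U (x - supportProj π Ω x))ᗮ := by
    refine supportSpace_le (Submodule.isClosed_orthogonal _) fun a ha => ?_
    rw [Submodule.mem_orthogonal_singleton_iff_inner_right]
    have := apply_mem_supportSpace (Ω := Ω) (h.compress_mem ha)
    change adjoint U (a (U Ω)) ∈ _ at this
    rw [← ContinuousLinearMap.adjoint_inner_right, ← h.map_vec]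
    exact (Submodule.mem_orthogonal' _ _).1 (Submodule.sub_starProjection_mem_orthogonal x) _ this
  have := (Submodule.mem_orthogonal_singleton_iff_inner_right).1 (h₂ hw)
  rwa [map_sub] at this

end IsIntertwiningIsometry

end Intertwiner

/-! ### The compressed normal extension of a state-preserving endomorphism. -/

section CompressedExtension

variable {B : Type*} [NonUnitalCStarAlgebra B]
variable {H : Type*} [NormedAddCommGroup H] [InnerProductSpace ℂ H] [CompleteSpace H]
variable {π : B →⋆ₙₐ[ℂ] (H →L[ℂ] H)} {Ω : H}

theorem apply_comm_of_mem {a X : H →L[ℂ] H} (ha : a ∈ piCommutant π) (hX : X ∈ piBicommutant π)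
    (ξ : H) : a (X ξ) = X (a ξ) :=
  congrArg (· ξ) (mem_piBicommutant.1 hX a ha)

theorem abs_mem_piCommutant {S : H →L[ℂ] H} (hS : star S * S ∈ piCommutant π) :
    CFC.abs S ∈ piCommutant π :=
  mem_piCommutant.2 fun b =>
    (Commute.cfcₙ_nnreal (show Commute (star S * S) (π b) from (mem_piCommutant.1 hS b).symm)
      NNReal.sqrt).symm

theorem norm_abs_apply (S : H →L[ℂ] H) (ξ : H) : ‖CFC.abs S ξ‖ = ‖S ξ‖ := by
  have h : ⟪CFC.abs S ξ, CFC.abs S ξ⟫_ℂ = ⟪S ξ, S ξ⟫_ℂ := by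
    rw [← inner_star_apply, ← inner_star_apply, (CFC.abs_nonneg S).isSelfAdjoint.star_eq]
    exact congrArg (fun T : H →L[ℂ] H => ⟪ξ, T ξ⟫_ℂ) (CFC.abs_mul_abs S)
  rw [inner_self_eq_norm_sq_to_K, inner_self_eq_norm_sq_to_K] at h
  exact (sq_eq_sq₀ (norm_nonneg _) (norm_nonneg _)).1 (by exact_mod_cast h)

/-- S need not commute with X, but |S| does, and |S| and S give vectors of equal norm. -/
theorem norm_apply_apply_le {S X : H →L[ℂ] H} (hS : star S * S ∈ piCommutant π)
    (hX : X ∈ piBicommutant π) (ξ : H) : ‖S (X ξ)‖ ≤ ‖X‖ * ‖S ξ‖ := by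
  rw [← norm_abs_apply S, apply_comm_of_mem (abs_mem_piCommutant hS) hX, ← norm_abs_apply S]
  exact X.le_opNorm _

/-- The commutant as a dense subset of the support space. -/
noncomputable def commutantOrbit (π : B →⋆ₙₐ[ℂ] (H →L[ℂ] H)) (Ω : H) :
    (piCommutant π).toStarSubalgebra →ₗ[ℂ] supportSpace π Ω where
  toFun a := ⟨(a : H →L[ℂ] H) Ω, apply_mem_supportSpace a.2⟩
  map_add' a b := by ext; simp
  map_smul' c a := by ext; simp

theorem denseRange_commutantOrbit : DenseRange (commutantOrbit π Ω) := by
  rw [Metric.denseRange_iff]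
  intro x r hr
  obtain ⟨y, hy, hxy⟩ := Metric.mem_closure_iff.1 (show (x : H) ∈ closure _ from x.2) r hr
  -- The orbit of Ω under the commutant is already a linear space, so taking the span adds nothing.
  have h : Submodule.span ℂ {ξ | ∃ a ∈ piCommutant π, ξ = a Ω} ≤
      LinearMap.range ((supportSpace π Ω).subtype ∘ₗ commutantOrbit π Ω) :=
    Submodule.span_le.2 (by rintro _ ⟨a, ha, rfl⟩; exact ⟨⟨a, ha⟩, rfl⟩)
  obtain ⟨a, rfl⟩ := h hy
  exact ⟨a, hxy⟩

/-- Operators that vanish on the complement of the support space are determined by their values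
on the vectors `a Ω`, `a` in the commutant. -/
theorem eq_of_eq_on_commutantOrbit {S T : H →L[ℂ] H} (hS : S * supportProj π Ω = S)
    (hT : T * supportProj π Ω = T) (h : ∀ a ∈ piCommutant π, S (a Ω) = T (a Ω)) : S = T := by
  have h₁ : S ∘L (supportSpace π Ω).subtypeL = T ∘L (supportSpace π Ω).subtypeL :=
    ContinuousLinearMap.coeFn_injective (denseRange_commutantOrbit.equalizer
      (ContinuousLinearMap.continuous _) (ContinuousLinearMap.continuous _)
      (funext fun a => h a a.2))
  rw [← hS, ← hT]
  ext x
  exact congrArg (fun R : supportSpace π Ω →L[ℂ] H => R ⟨_, supportProj_apply_mem x⟩) h₁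

variable {α : B →⋆ₙₐ[ℂ] B} {V : H →L[ℂ] H}

open ContinuousLinearMap (adjoint)

/-- PVP = PV: the isometry turns P into the support projection of π∘α, which dominates P. Elements
of the corner applied after V therefore only see the component of a vector in K. -/
theorem IsIntertwiningIsometry.supportProj_apply (hV : IsIntertwiningIsometry π Ω (π.comp α) Ω V)
    (x : H) : supportProj π Ω (V (supportProj π Ω x)) = supportProj π Ω (V x) := by
  rw [hV.map_supportProj]
  refine ext_inner_right ℂ fun y => ?_
  rw [← inner_supportProj, ← inner_supportProj, ← inner_supportProj,
    supportProj_eq_self (supportSpace_le_comp α (supportProj_apply_mem y))]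

theorem star_mul_comp_mem (hV : IsIntertwiningIsometry π Ω (π.comp α) Ω V) {a : H →L[ℂ] H}
    (ha : a ∈ piCommutant π) : star (a * V) * (a * V) ∈ piCommutant π := by
  have h := hV.compress_mem (piCommutant_le_comp α (mul_mem (star_mem ha) ha))
  convert h using 1
  rw [star_mul]
  rfl

/-- The compression of the normal extension of an endomorphism `α` by the support projection,
expressed by the isometry `V` that implements `α`. -/
theorem exists_compressedOperator (hV : IsIntertwiningIsometry π Ω (π.comp α) Ω V)
    {X : H →L[ℂ] H} (hX : X ∈ piBicommutant π) : ∃ T : H →L[ℂ] H,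
      (∀ a ∈ piCommutant π, T (a Ω) = supportProj π Ω (a (V (X Ω)))) ∧
      T * supportProj π Ω = T ∧ ‖T‖ ≤ ‖X‖ := by
  -- If α did extend normally, α(X)aΩ would equal aα(X)Ω = aVXΩ. This formula is taken as the
  -- definition.
  let k : (piCommutant π).toStarSubalgebra →ₗ[ℂ] H :=
    { toFun := fun a => supportProj π Ω ((a : H →L[ℂ] H) (V (X Ω)))
      map_add' := fun a b => by simp
      map_smul' := fun c a => by simp }
  -- Since (aV)*(aV) lies in π(B)', the norm of aVXΩ is at most ‖X‖‖aVΩ‖ = ‖X‖‖aΩ‖.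
  have hk : ∀ a, ‖k a‖ ≤ ‖X‖ * ‖commutantOrbit π Ω a‖ := fun a => by
    refine (norm_supportProj_apply_le _).trans ?_
    refine (norm_apply_apply_le (S := (a : H →L[ℂ] H) * V) (star_mul_comp_mem hV a.2) hX Ω).trans_eq ?_
    change ‖X‖ * ‖(a : H →L[ℂ] H) (V Ω)‖ = _
    rw [hV.map_vec]
    rfl
  set T₀ := k.extendOfNorm (commutantOrbit π Ω)
  have hT₀ : ∀ a, T₀ (commutantOrbit π Ω a) = k a :=
    LinearMap.extendOfNorm_eq denseRange_commutantOrbit ⟨_, hk⟩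
  have hproj : ∀ x (hx : x ∈ supportSpace π Ω),
      (supportSpace π Ω).orthogonalProjectionOnto x = ⟨x, hx⟩ := fun x hx =>
    Subtype.ext (supportProj_eq_self hx)
  refine ⟨T₀ ∘L (supportSpace π Ω).orthogonalProjectionOnto, fun a ha => ?_, ?_, ?_⟩
  · rw [ContinuousLinearMap.comp_apply, hproj _ (apply_mem_supportSpace ha)]
    exact hT₀ ⟨a, ha⟩
  · ext x
    exact congrArg T₀ (hproj _ (supportProj_apply_mem x))
  · refine ContinuousLinearMap.opNorm_le_bound _ (norm_nonneg _) fun x => ?_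
    refine (LinearMap.norm_extendOfNorm_apply_le denseRange_commutantOrbit _ hk _).trans ?_
    exact mul_le_mul_of_nonneg_left (norm_supportProj_apply_le x) (norm_nonneg _)

/-- The existence of the compressed normal extension of a state preserving endomorphism,
together with its description by the implementing isometry. -/
theorem exists_isCompressedExtension (hV : IsIntertwiningIsometry π Ω (π.comp α) Ω V) :
    ∃ Φ, IsCompressedExtension π Ω α Φ ∧
      (∀ X, (Φ X : H →L[ℂ] H) Ω = supportProj π Ω (V ((X : H →L[ℂ] H) Ω))) ∧
      ∀ X, (Φ (star X) : H →L[ℂ] H) = star (Φ X : H →L[ℂ] H) := by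
  choose T hT hTP hTn using fun X : (piBicommutant π).toStarSubalgebra =>
    exists_compressedOperator hV X.2
  have hPT : ∀ X, supportProj π Ω * T X = T X := fun X => by
    refine eq_of_eq_on_commutantOrbit (π := π) (Ω := Ω) (by rw [mul_assoc, hTP]) (hTP X)
      fun a ha => ?_
    change supportProj π Ω (T X (a Ω)) = _
    rw [hT X a ha, supportProj_eq_self (supportProj_apply_mem _)]
  have hmem : ∀ X, T X ∈ corner π Ω := fun X => by
    refine mem_corner_iff.2 ⟨mem_piBicommutant.2 fun c hc => ?_, hPT X, hTP X⟩
    have hPc : c * supportProj π Ω = supportProj π Ω * c :=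
      mem_piBicommutant.1 (supportProj_mem π Ω) c hc
    refine eq_of_eq_on_commutantOrbit (π := π) (Ω := Ω) (by rw [mul_assoc, hTP])
      (by rw [mul_assoc, hPc, ← mul_assoc, hTP]) fun a ha => ?_
    change c (T X (a Ω)) = T X ((c * a) Ω)
    rw [hT X a ha, hT X _ (mul_mem hc ha), commute_supportProj hc]
    rfl
  let Φ : (piBicommutant π).toStarSubalgebra →ₗ[ℂ] corner π Ω :=
    { toFun := fun X => ⟨T X, hmem X⟩
      map_add' := fun X Y => Subtype.ext <| eq_of_eq_on_commutantOrbit (π := π) (Ω := Ω) (hTP _)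
        (by change (T X + T Y) * _ = T X + T Y; rw [add_mul, hTP, hTP]) fun a ha => by
          change T (X + Y) (a Ω) = T X (a Ω) + T Y (a Ω)
          rw [hT _ a ha, hT _ a ha, hT _ a ha]
          simp
      map_smul' := fun c X => Subtype.ext <| eq_of_eq_on_commutantOrbit (π := π) (Ω := Ω) (hTP _)
        (by change (c • T X) * _ = c • T X; rw [smul_mul_assoc, hTP]) fun a ha => by
          change T (c • X) (a Ω) = c • T X (a Ω)
          rw [hT _ a ha, hT _ a ha]
          simp }
  have hΦ : ∀ X, (Φ X : H →L[ℂ] H) = T X := fun _ => rfl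
  refine ⟨Φ, ⟨?_, fun b hb => ?_⟩, fun X => ?_, fun X => ?_⟩
  · intro l X ⟨r, hr⟩ hlim ξ η
    simp only [hΦ]
    -- On a vector aΩ each matrix coefficient of T(Y) is a matrix coefficient of Y at Ω. Other
    -- vectors are reached by density, using the uniform bound on Y; this is where boundedness of
    -- the net enters.
    have h₁ : ∀ a ∈ piCommutant π,
        Tendsto (fun Y => ⟪ξ, T Y (a Ω)⟫_ℂ) l (𝓝 ⟪ξ, T X (a Ω)⟫_ℂ) := by
      intro a ha
      have h₂ : ∀ Y, ⟪ξ, T Y (a Ω)⟫_ℂ =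
          ⟪adjoint V (star a (supportProj π Ω ξ)), (Y : H →L[ℂ] H) Ω⟫_ℂ := fun Y => by
        rw [hT Y a ha, inner_supportProj, ContinuousLinearMap.adjoint_inner_left,
          ← inner_star_apply (star a), star_star]
      simp only [h₂]
      exact hlim _ _
    have h₂ : ∀ Y, ⟪ξ, T Y η⟫_ℂ = ⟪ξ, T Y (supportProj π Ω η)⟫_ℂ := fun Y => 
      congrArg (fun S : H →L[ℂ] H => ⟪ξ, S η⟫_ℂ) (hTP Y).symm
    simp only [h₂]
    rw [Metric.tendsto_nhds]
    intro ε hε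
    set R := max r ‖(X : H →L[ℂ] H)‖ with hR
    have hR0 : 0 ≤ R := (norm_nonneg _).trans (le_max_right _ _)
    obtain ⟨a, ha⟩ := Metric.denseRange_iff.1 (denseRange_commutantOrbit (π := π) (Ω := Ω))
      ⟨_, supportProj_apply_mem η⟩ (ε / (3 * (‖ξ‖ * R + 1))) (by positivity)
    have ha' : ‖supportProj π Ω η - (a : H →L[ℂ] H) Ω‖ < ε / (3 * (‖ξ‖ * R + 1)) := by
      rw [← dist_eq_norm]; exact ha
    have hε' : ‖ξ‖ * (R * (ε / (3 * (‖ξ‖ * R + 1)))) ≤ ε / 3 := by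
      rw [mul_div_assoc', mul_div_assoc', div_le_div_iff₀ (by positivity) (by positivity)]
      nlinarith [norm_nonneg ξ]
    have h₃ : ∀ Y : (piBicommutant π).toStarSubalgebra, ‖(Y : H →L[ℂ] H)‖ ≤ R →
        dist ⟪ξ, T Y (supportProj π Ω η)⟫_ℂ ⟪ξ, T Y ((a : H →L[ℂ] H) Ω)⟫_ℂ ≤ ε / 3 := by
      intro Y hY
      rw [dist_eq_norm, ← inner_sub_right, ← map_sub]
      refine (norm_inner_le_norm _ _).trans (le_trans ?_ hε')
      refine mul_le_mul_of_nonneg_left ?_ (norm_nonneg _)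
      refine ((T Y).le_opNorm _).trans ?_
      exact mul_le_mul ((hTn Y).trans hY) ha'.le (norm_nonneg _) hR0
    filter_upwards [hr, Metric.tendsto_nhds.1 (h₁ a a.2) (ε / 3) (by positivity)] with Y hY hY'
    have h₄ := h₃ Y (hY.trans (le_max_left _ _))
    have h₅ := h₃ X (le_max_right _ _)
    rw [dist_comm] at h₅
    calc _ ≤ _ + _ + _ := dist_triangle4 _ _ _ _
      _ < ε := by linarith
  · rw [hΦ]
    refine eq_of_eq_on_commutantOrbit (π := π) (Ω := Ω) (hTP _)
      (by rw [mul_assoc, supportProj_mul_self]) fun a ha => ?_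
    rw [hT _ a ha]
    change supportProj π Ω (a (V (π b Ω))) = supportProj π Ω (π (α b) (supportProj π Ω (a Ω)))
    rw [hV.comm, hV.map_vec, supportProj_eq_self (apply_mem_supportSpace ha),
      mem_piCommutant_iff_apply.1 ha]
    rfl
  · have := hT X 1 (one_mem _)
    exact this
  · rw [hΦ, hΦ]
    refine eq_of_eq_on_commutantOrbit (π := π) (Ω := Ω) (hTP _)
      (by rw [← congrArg star (hPT X), star_mul, star_supportProj, mul_assoc,
        supportProj_mul_self]) fun b hb => ?_
    -- Compatibility with adjoints is not visible in the defining formula. The difference w lies in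
    -- K and is shown to be orthogonal to K.
    set w := T (star X) (b Ω) - star (T X) (b Ω) with hw
    have hmem' : ∀ {S : H →L[ℂ] H}, S ∈ corner π Ω → ∀ x, S x ∈ supportSpace π Ω := fun hS x => by
      rw [← (mem_corner_iff.1 hS).2.1]
      exact supportProj_apply_mem _
    have hwK : w ∈ supportSpace π Ω := sub_mem (hmem' (hmem _) _) (hmem' (star_mem_corner (hmem _)) _)
    have horth : supportSpace π Ω ≤ (ℂ ∙ w)ᗮ := by
      refine supportSpace_le (Submodule.isClosed_orthogonal _) fun a ha => ?_
      rw [Submodule.mem_orthogonal_singleton_iff_inner_right, hw, inner_sub_left, sub_eq_zero]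
      -- This operator of the commutant lets X pass from one side of the inner product to the other.
      have hσ : adjoint V ∘L (star b * a) ∘L V ∈ piCommutant π :=
        hV.compress_mem (piCommutant_le_comp α (mul_mem (star_mem hb) ha))
      have hc := apply_comm_of_mem hσ X.2 Ω
      calc ⟪T (star X) (b Ω), a Ω⟫_ℂ
          = ⟪b (V (star (X : H →L[ℂ] H) Ω)), a Ω⟫_ℂ := by
            rw [hT _ b hb, ← inner_supportProj, supportProj_eq_self (apply_mem_supportSpace ha)]
            rfl
        _ = ⟪star (X : H →L[ℂ] H) Ω, (adjoint V ∘L (star b * a) ∘L V) Ω⟫_ℂ := by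
            simp only [ContinuousLinearMap.comp_apply]
            rw [ContinuousLinearMap.adjoint_inner_right, hV.map_vec]
            exact (inner_star_apply b _ _).symm
        _ = ⟪Ω, (adjoint V ∘L (star b * a) ∘L V) ((X : H →L[ℂ] H) Ω)⟫_ℂ := by
            rw [← inner_star_apply, star_star, hc]
        _ = ⟪b Ω, a (V ((X : H →L[ℂ] H) Ω))⟫_ℂ := by
            simp only [ContinuousLinearMap.comp_apply]
            rw [ContinuousLinearMap.adjoint_inner_right, hV.map_vec]
            exact inner_star_apply b _ _
        _ = ⟪star (T X) (b Ω), a Ω⟫_ℂ := by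
            rw [← inner_star_apply (star (T X)), star_star, hT X a ha, inner_supportProj,
              supportProj_eq_self (apply_mem_supportSpace hb)]
    exact eq_of_sub_eq_zero (inner_self_eq_zero.1
      (Submodule.mem_orthogonal_singleton_iff_inner_right.1 (horth hwK)))

end CompressedExtension

/-! ### Strong density of the image of a representation in its bicommutant. -/

section Density

variable {B : Type*} [NonUnitalCStarAlgebra B]
variable {H : Type*} [NormedAddCommGroup H] [InnerProductSpace ℂ H] [CompleteSpace H]

/-- If operators approximate `X` on every finite set of vectors, then some filter of them converges
strongly to `X`. -/
theorem exists_filter_of_forall_finset {ι : Type*} {F : ι → H →L[ℂ] H} {X : H →L[ℂ] H}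
    (h : ∀ (s : Finset H) (ε : ℝ), 0 < ε → ∃ i, ∀ ξ ∈ s, ‖F i ξ - X ξ‖ < ε) :
    ∃ l : Filter ι, l.NeBot ∧ ∀ ξ, Tendsto (fun i => F i ξ) l (𝓝 (X ξ)) := by
  -- The filter consists of the preimages of neighbourhoods of X for pointwise convergence on H; the
  -- hypothesis says that it is proper.
  refine ⟨comap (fun i ξ => F i ξ) (𝓝 fun ξ => X ξ), ?_, fun ξ =>
    (tendsto_pi_nhds.1 (tendsto_comap (f := fun i ξ => F i ξ) (x := 𝓝 fun ξ => X ξ)) ξ)⟩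
  rw [comap_neBot_iff]
  intro t ht
  rw [nhds_pi, Filter.mem_pi'] at ht
  obtain ⟨s, u, hu, hst⟩ := ht
  choose e he heu using fun ξ => Metric.mem_nhds_iff.1 (hu ξ)
  have h₁ : ∀ᶠ ε in 𝓝[>] (0 : ℝ), ∀ ξ ∈ s, ε < e ξ :=
    (Finset.eventually_all s).2 fun ξ _ => nhdsWithin_le_nhds (eventually_lt_nhds (he ξ))
  obtain ⟨ε, hε, hε₀⟩ := (h₁.and self_mem_nhdsWithin).exists
  obtain ⟨i, hi⟩ := h s ε hε₀
  exact ⟨i, hst fun ξ hξ => heu ξ (by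
    rw [Metric.mem_ball, dist_eq_norm]; exact (hi ξ hξ).trans (hε ξ hξ))⟩

section Direct

variable {ι : Type*} [Fintype ι] [DecidableEq ι]

/-- The diagonal operator on a finite direct sum of copies of `H`. -/
noncomputable def diag (ι : Type*) [Fintype ι] (T : H →L[ℂ] H) :
    PiLp 2 (fun _ : ι => H) →L[ℂ] PiLp 2 (fun _ : ι => H) :=
  ((PiLp.continuousLinearEquiv 2 ℂ fun _ : ι => H).symm : (ι → H) →L[ℂ] _) ∘L
    (ContinuousLinearMap.pi fun i => T ∘L ContinuousLinearMap.proj i) ∘L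
      ((PiLp.continuousLinearEquiv 2 ℂ fun _ : ι => H) : _ →L[ℂ] (ι → H))

theorem diag_apply (T : H →L[ℂ] H) (x : PiLp 2 (fun _ : ι => H)) (i : ι) :
    diag ι T x i = T (x i) := rfl

/-- The inclusion of a summand of a finite direct sum of copies of `H`. -/
noncomputable def incl (i : ι) : H →L[ℂ] PiLp 2 (fun _ : ι => H) :=
  ((PiLp.continuousLinearEquiv 2 ℂ fun _ : ι => H).symm : (ι → H) →L[ℂ] _) ∘L
    ContinuousLinearMap.single ℂ (fun _ : ι => H) i

theorem incl_apply (i j : ι) (x : H) : incl i x j = (Pi.single i x : ι → H) j := rfl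

theorem sum_incl (x : PiLp 2 (fun _ : ι => H)) : ∑ i, incl i (x i) = x := by
  ext j
  rw [WithLp.ofLp_sum, Finset.sum_apply]
  simp only [incl_apply]
  exact Finset.sum_pi_single j x.ofLp Finset.univ |>.trans (if_pos (Finset.mem_univ j))

theorem diag_incl (T : H →L[ℂ] H) (i : ι) (x : H) : diag ι T (incl i x) = incl i (T x) := by
  ext j
  rw [diag_apply, incl_apply, incl_apply]
  exact (Pi.apply_single (fun _ => T) (fun _ => map_zero T) i x j)

variable {π : B →⋆ₙₐ[ℂ] (H →L[ℂ] H)}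

/-- An operator that commutes with the amplification of `π` commutes with the amplification of the
bicommutant. -/
theorem diag_comm {A : PiLp 2 (fun _ : ι => H) →L[ℂ] PiLp 2 (fun _ : ι => H)}
    (hA : ∀ b x, A (diag ι (π b) x) = diag ι (π b) (A x)) {X : H →L[ℂ] H}
    (hX : X ∈ piBicommutant π) (x : PiLp 2 (fun _ : ι => H)) :
    A (diag ι X x) = diag ι X (A x) := by
  have h : ∀ j y, A (diag ι X (incl j y)) = diag ι X (A (incl j y)) := by
    intro j y
    ext i
    -- The matrix entries of A belong to the commutant of π.
    let a : H →L[ℂ] H := (PiLp.proj 2 (𝕜 := ℂ) (fun _ : ι => H) i) ∘L A ∘L incl j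
    have ha : a ∈ piCommutant π := mem_piCommutant_iff_apply.2 fun b x => by
      change diag ι (π b) (A (incl j x)) i = A (incl j (π b x)) i
      rw [← diag_incl, hA]
    rw [diag_incl, diag_apply]
    exact apply_comm_of_mem ha hX y
  rw [← sum_incl x]
  simp only [map_sum, h]

/-- The finite vector form of the double commutant theorem. -/
theorem exists_norm_sub_lt (hnd : ∀ ζ : H, (∀ b, π b ζ = 0) → ζ = 0) {X : H →L[ℂ] H}
    (hX : X ∈ piBicommutant π) (ξ : ι → H) {ε : ℝ} (hε : 0 < ε) :
    ∃ b, ∀ i, ‖π b (ξ i) - X (ξ i)‖ < ε := by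
  set ξ' : PiLp 2 (fun _ : ι => H) := WithLp.toLp 2 ξ
  let f : B →ₗ[ℂ] PiLp 2 (fun _ : ι => H) :=
    { toFun := fun b => diag ι (π b) ξ'
      map_add' := fun a b => by ext i; simp [diag_apply]
      map_smul' := fun c b => by ext i; simp [diag_apply] }
  -- Von Neumann's argument: the projection onto this closed invariant subspace commutes with the
  -- amplification of π, hence with that of X.
  set S := (LinearMap.range f).topologicalClosure with hS
  have : CompleteSpace S := inferInstanceAs (CompleteSpace (Submodule.topologicalClosure _))
  have hinv : ∀ b, ∀ x ∈ S, diag ι (π b) x ∈ S := by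
    intro b x hx
    refine map_mem_closure (s := LinearMap.range f) (diag ι (π b)).continuous hx ?_
    rintro _ ⟨c, rfl⟩
    refine ⟨b * c, ?_⟩
    ext i
    exact map_mul_apply π b c _
  have hadj : ∀ b x y, ⟪diag ι (π b) x, y⟫_ℂ = ⟪x, diag ι (π (star b)) y⟫_ℂ := by
    intro b x y
    simp only [PiLp.inner_apply, diag_apply, inner_map_star]
  have hcomm : ∀ b x, S.starProjection (diag ι (π b) x) = diag ι (π b) (S.starProjection x) := by
    intro b x
    refine Submodule.eq_starProjection_of_mem_of_inner_eq_zero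
      (hinv b _ (Submodule.starProjection_apply_mem _ x)) fun w hw => ?_
    rw [← map_sub, hadj]
    exact (Submodule.mem_orthogonal' _ _).1 (Submodule.sub_starProjection_mem_orthogonal x) _
      (hinv _ w hw)
  -- With a unit this would be immediate; here nondegeneracy kills the component of ξ' orthogonal to
  -- S.
  have hξ : S.starProjection ξ' = ξ' := by
    have h₀ : ∀ b, diag ι (π b) (ξ' - S.starProjection ξ') = 0 := fun b => by
      rw [map_sub, ← hcomm, sub_eq_zero, eq_comm]
      exact Submodule.starProjection_eq_self_iff.2 (Submodule.le_topologicalClosure _ ⟨b, rfl⟩)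
    refine (eq_of_sub_eq_zero ?_).symm
    ext i
    refine hnd _ fun b => ?_
    have := congrArg (fun x : PiLp 2 (fun _ : ι => H) => x i) (h₀ b)
    exact this
  have hmem : diag ι X ξ' ∈ S := by
    rw [← hξ, ← diag_comm hcomm hX]
    exact Submodule.starProjection_apply_mem _ _
  obtain ⟨_, ⟨b, rfl⟩, hb⟩ := Metric.mem_closure_iff.1
    (show diag ι X ξ' ∈ closure (LinearMap.range f : Set _) from hmem) ε hε
  refine ⟨b, fun i => lt_of_le_of_lt ?_ hb⟩
  rw [dist_comm, dist_eq_norm]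
  exact PiLp.norm_apply_le (f b - diag ι X ξ') i

end Direct

variable {π : B →⋆ₙₐ[ℂ] (H →L[ℂ] H)}

theorem exists_filter_tendsto (hnd : ∀ ζ : H, (∀ b, π b ζ = 0) → ζ = 0) {X : H →L[ℂ] H}
    (hX : X ∈ piBicommutant π) :
    ∃ l : Filter B, l.NeBot ∧ ∀ ξ, Tendsto (fun b => π b ξ) l (𝓝 (X ξ)) := by
  classical
  refine exists_filter_of_forall_finset fun s ε hε => ?_
  obtain ⟨b, hb⟩ := exists_norm_sub_lt hnd hX (fun x : s => (x : H)) hε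
  exact ⟨b, fun ξ hξ => hb ⟨ξ, hξ⟩⟩

/-- A selfadjoint element of the bicommutant is a strong limit of images of selfadjoint elements. -/
theorem exists_isSelfAdjoint_norm_sub_lt (hnd : ∀ ζ : H, (∀ b, π b ζ = 0) → ζ = 0)
    {X : H →L[ℂ] H} (hX : X ∈ piBicommutant π) (hX' : IsSelfAdjoint X) {ι : Type*} [Fintype ι]
    (ξ : ι → H) {ε : ℝ} (hε : 0 < ε) :
    ∃ b, IsSelfAdjoint b ∧ ∀ i, ‖π b (ξ i) - X (ξ i)‖ < ε := by
  classical
  obtain ⟨l, hl, hlim⟩ := exists_filter_tendsto hnd hX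
  -- Selfadjoint elements only form a real subspace, so the projection is taken in the underlying
  -- real Hilbert space.
  let _ := InnerProductSpace.rclikeToReal ℂ (PiLp 2 (fun _ : ι => H))
  set ξ' : PiLp 2 (fun _ : ι => H) := WithLp.toLp 2 ξ
  let f : selfAdjoint B →ₗ[ℝ] PiLp 2 (fun _ : ι => H) :=
    { toFun := fun b => diag ι (π b) ξ'
      map_add' := fun a b => by ext i; simp [diag_apply]
      map_smul' := fun c b => by
        ext i
        change π (c • (b : B)) (ξ i) = c • π b (ξ i)
        rw [← Complex.coe_smul, map_smul, ← Complex.coe_smul]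
        rfl }
  set S := (LinearMap.range f).topologicalClosure with hS
  have : CompleteSpace S := inferInstanceAs (CompleteSpace (Submodule.topologicalClosure _))
  set η := diag ι X ξ' - S.starProjection (diag ι X ξ') with hη
  have horth : ∀ y ∈ S, (⟪η, y⟫_ℂ).re = 0 := fun y hy =>
    (Submodule.mem_orthogonal' _ _).1 (Submodule.sub_starProjection_mem_orthogonal _) y hy
  -- The adjoint is not strongly continuous, but weak convergence of the real parts is enough: it
  -- makes η orthogonal to the amplified X applied to ξ', and hence to itself.
  have h₁ : Tendsto (fun b => (⟪η, diag ι (π ((2⁻¹ : ℝ) • (b + star b))) ξ'⟫_ℂ).re) l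
      (𝓝 (⟪η, diag ι X ξ'⟫_ℂ).re) := by
    have h₂ : ∀ b, ⟪η, diag ι (π ((2⁻¹ : ℝ) • (b + star b))) ξ'⟫_ℂ =
        2⁻¹ * ∑ i, (⟪η i, π b (ξ i)⟫_ℂ + ⟪π b (η i), ξ i⟫_ℂ) := by
      intro b
      rw [PiLp.inner_apply, Finset.mul_sum]
      refine Finset.sum_congr rfl fun i _ => ?_
      rw [diag_apply, ← inner_map_star, ← inner_add_right, ← Complex.coe_smul, map_smul, map_add]
      simp only [_root_.smul_apply, _root_.add_apply, inner_smul_right]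
      simp [ξ']
    have h₃ : ⟪η, diag ι X ξ'⟫_ℂ = 2⁻¹ * ∑ i, (⟪η i, X (ξ i)⟫_ℂ + ⟪X (η i), ξ i⟫_ℂ) := by
      rw [PiLp.inner_apply, Finset.mul_sum]
      refine Finset.sum_congr rfl fun i _ => ?_
      rw [diag_apply, ← inner_star_apply, hX'.star_eq]
      change ⟪η i, X (ξ i)⟫_ℂ = _
      ring
    simp only [h₂, h₃]
    refine (Complex.continuous_re.tendsto _).comp (Tendsto.const_mul _ ?_)
    exact tendsto_finsetSum _ fun i _ =>
      (tendsto_const_nhds.inner (hlim _)).add ((hlim _).inner tendsto_const_nhds)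
  have h₂ : (⟪η, diag ι X ξ'⟫_ℂ).re = 0 := by
    refine tendsto_nhds_unique h₁ (tendsto_const_nhds.congr fun b => ?_)
    refine (horth _ (Submodule.le_topologicalClosure _
      ⟨⟨(2⁻¹ : ℝ) • (b + star b), ?_⟩, rfl⟩)).symm
    exact (IsSelfAdjoint.all _).smul (IsSelfAdjoint.add_star_self b)
  have h₃ : η = 0 := by
    have h₄ := horth _ (Submodule.starProjection_apply_mem S (diag ι X ξ'))
    have h₅ : (⟪η, η⟫_ℂ).re = 0 := by
      nth_rewrite 2 [hη]
      rw [inner_sub_right, Complex.sub_re, h₂, h₄, sub_zero]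
    rw [inner_self_eq_norm_sq_to_K] at h₅
    rw [← norm_eq_zero, ← sq_eq_zero_iff]
    exact_mod_cast h₅
  have hmem : diag ι X ξ' ∈ S := by
    rw [eq_of_sub_eq_zero h₃]
    exact Submodule.starProjection_apply_mem _ _
  obtain ⟨_, ⟨b, rfl⟩, hb⟩ := Metric.mem_closure_iff.1
    (show diag ι X ξ' ∈ closure (LinearMap.range f : Set _) from hmem) ε hε
  refine ⟨b, b.2, fun i => lt_of_le_of_lt ?_ hb⟩
  rw [dist_comm, dist_eq_norm]
  exact PiLp.norm_apply_le (f b - diag ι X ξ') i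

/-- A selfadjoint element of the bicommutant is a strong limit of images of selfadjoint elements
of a dense subset of the selfadjoint part. -/
theorem exists_filter_isSelfAdjoint_tendsto (hnd : ∀ ζ : H, (∀ b, π b ζ = 0) → ζ = 0)
    {X : H →L[ℂ] H} (hX : X ∈ piBicommutant π) (hX' : IsSelfAdjoint X) {D : Set B}
    (hD : ∀ b, IsSelfAdjoint b → ∀ ε : ℝ, 0 < ε → ∃ d ∈ D, IsSelfAdjoint d ∧ ‖d - b‖ < ε) :
    ∃ l : Filter {d : B // d ∈ D ∧ IsSelfAdjoint d}, l.NeBot ∧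
      ∀ ξ, Tendsto (fun d : {d : B // d ∈ D ∧ IsSelfAdjoint d} => π d ξ) l (𝓝 (X ξ)) := by
  refine exists_filter_of_forall_finset fun s ε hε => ?_
  obtain ⟨b, hb, hbs⟩ := exists_isSelfAdjoint_norm_sub_lt hnd hX hX' (fun x : s => (x : H))
    (half_pos hε)
  obtain ⟨R, hR⟩ : ∃ R : ℝ, ∀ ξ ∈ s, ‖ξ‖ ≤ R := by
    refine ⟨∑ ξ ∈ s, ‖ξ‖, fun ξ hξ => ?_⟩
    exact Finset.single_le_sum (f := fun ξ : H => ‖ξ‖) (fun _ _ => norm_nonneg _) hξ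
  obtain ⟨d, hd, hd', hdb⟩ := hD b hb (ε / (2 * (|R| + 1))) (by positivity)
  refine ⟨⟨d, hd, hd'⟩, fun ξ hξ => ?_⟩
  have h₁ : ‖π (d - b) ξ‖ ≤ ε / 2 := by
    refine (norm_map_apply_le π _ ξ).trans ?_
    calc ‖d - b‖ * ‖ξ‖ ≤ ε / (2 * (|R| + 1)) * (|R| + 1) :=
          mul_le_mul hdb.le ((hR ξ hξ).trans ((le_abs_self R).trans (by linarith)))
            (norm_nonneg _) (by positivity)
      _ = ε / 2 := by field_simp
  have h₂ : π d ξ - X ξ = π (d - b) ξ + (π b ξ - X ξ) := by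
    rw [map_sub]; simp
  rw [h₂]
  exact (norm_add_le _ _).trans_lt (by linarith [hbs ⟨ξ, hξ⟩])

end Density

/-! ### The bounded transform and its strong continuity. -/

section BoundedTransform

/-- The bounded transform `2b / (1 + b²)` of a selfadjoint element of a C⋆-algebra. -/
theorem exists_boundedTransform {B : Type*} [NonUnitalCStarAlgebra B] {b : B}
    (hb : IsSelfAdjoint b) : ∃ f : B, ‖f‖ ≤ 1 ∧ f + b * b * f = b + b ∧
      ∀ c, Commute b c → Commute f c := by
  have hpos : ∀ t : ℝ, 1 + t ^ 2 ≠ 0 := fun t => by positivity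
  -- The bound |2t| ≤ 1 + t² gives norm at most one, and g(0) = 0 keeps the calculus inside a
  -- nonunital algebra. The resulting equation f + b²f = 2b, unlike the calculus itself, is
  -- trivially preserved by homomorphisms.
  let g : ℝ → ℝ := fun t => 2 * t / (1 + t ^ 2)
  have hg : Continuous g := by fun_prop (disch := exact hpos _)
  have hg₀ : g 0 = 0 := by simp [g]
  refine ⟨cfcₙ g b, norm_cfcₙ_le fun t _ => ?_, ?_, fun c hc => hc.cfcₙ_real g⟩
  · rw [Real.norm_eq_abs, abs_div, abs_of_pos (by positivity : 0 < 1 + t ^ 2),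
      div_le_one (by positivity), abs_le]
    constructor <;> nlinarith [sq_nonneg (t - 1), sq_nonneg (t + 1)]
  · have h₁ : b * b * cfcₙ g b = cfcₙ (fun t => t * t * g t) b := by
      rw [cfcₙ_mul (fun t : ℝ => t * t) g b, cfcₙ_mul (fun t : ℝ => t) (fun t => t) b,
        cfcₙ_id' ℝ b]
    have h₂ : b + b = cfcₙ (fun t : ℝ => t + t) b := by
      rw [cfcₙ_add (fun t : ℝ => t) (fun t => t) b, cfcₙ_id' ℝ b]
    rw [h₁, h₂, ← cfcₙ_add g (fun t => t * t * g t) b]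
    congr 1
    ext t
    simp only [g]
    field_simp [hpos t]
    ring

variable {H : Type*} [NormedAddCommGroup H] [InnerProductSpace ℂ H] [CompleteSpace H]

/-- If `ζ + y²ζ = v + yw` with `y` selfadjoint, then `ζ` is small when `v` and `w` are. -/
theorem norm_sq_le_of_add_eq {y : H →L[ℂ] H} (hy : IsSelfAdjoint y) {ζ v w : H}
    (h : ζ + y (y ζ) = v + y w) : ‖ζ‖ ^ 2 ≤ ‖v‖ ^ 2 + ‖w‖ ^ 2 := by
  have hsymm : ∀ a b : H, ⟪a, y b⟫_ℂ = ⟪y a, b⟫_ℂ := fun a b => by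
    rw [← inner_star_apply, hy.star_eq]
  -- Pairing with ζ moves y from w to ζ, and the left side also controls yζ. The estimate is thus
  -- independent of ‖y‖, which need not be bounded along the filter.
  have h₁ : ‖ζ‖ ^ 2 + ‖y ζ‖ ^ 2 = (⟪ζ, v⟫_ℂ).re + (⟪y ζ, w⟫_ℂ).re := by
    have : (⟪ζ, ζ + y (y ζ)⟫_ℂ).re = (⟪ζ, v + y w⟫_ℂ).re := by rw [h]
    rw [inner_add_right, inner_add_right, hsymm ζ (y ζ), hsymm ζ w, Complex.add_re, Complex.add_re,
      inner_self_eq_norm_sq_to_K, inner_self_eq_norm_sq_to_K] at this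
    exact_mod_cast this
  have h₂ : (⟪ζ, v⟫_ℂ).re ≤ ‖ζ‖ * ‖v‖ := (Complex.re_le_norm _).trans (norm_inner_le_norm _ _)
  have h₃ : (⟪y ζ, w⟫_ℂ).re ≤ ‖y ζ‖ * ‖w‖ := (Complex.re_le_norm _).trans (norm_inner_le_norm _ _)
  nlinarith [sq_nonneg (‖ζ‖ - ‖v‖), sq_nonneg (‖y ζ‖ - ‖w‖), sq_nonneg (‖y ζ‖)]

/-- The bounded transform is strongly continuous. -/
theorem tendsto_boundedTransform {ι : Type*} {l : Filter ι} {y F : ι → H →L[ℂ] H}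
    {Y G : H →L[ℂ] H} (hy : ∀ i, IsSelfAdjoint (y i)) (hF : ∀ i, F i + y i * y i * F i = y i + y i)
    (hG : G + Y * Y * G = Y + Y) (hlim : ∀ ξ, Tendsto (fun i => y i ξ) l (𝓝 (Y ξ))) (ξ : H) :
    Tendsto (fun i => F i ξ) l (𝓝 (G ξ)) := by
  have hF' : ∀ i, F i ξ + y i (y i (F i ξ)) = y i ξ + y i ξ := fun i => congrArg (· ξ) (hF i)
  have hG' : G ξ + Y (Y (G ξ)) = Y ξ + Y ξ := congrArg (· ξ) hG
  -- Subtracting the two equations gives v + yw. Only values of y - Y at the fixed vectors ξ, YGξ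
  -- and Gξ occur in v and w.
  let v : ι → H := fun i => (y i ξ - Y ξ) + (y i ξ - Y ξ) - (y i (Y (G ξ)) - Y (Y (G ξ)))
  let w : ι → H := fun i => -(y i (G ξ) - Y (G ξ))
  have hd : ∀ η, Tendsto (fun i => y i η - Y η) l (𝓝 0) := fun η => by
    simpa using (hlim η).sub_const (Y η)
  have hv : Tendsto v l (𝓝 0) := by
    simpa using ((hd ξ).add (hd ξ)).sub (hd (Y (G ξ)))
  have hw : Tendsto w l (𝓝 0) := by simpa only [neg_zero] using (hd (G ξ)).neg
  rw [tendsto_iff_norm_sub_tendsto_zero]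
  have hle : ∀ i, ‖F i ξ - G ξ‖ ^ 2 ≤ ‖v i‖ ^ 2 + ‖w i‖ ^ 2 := fun i => by
    refine norm_sq_le_of_add_eq (hy i) ?_
    simp only [v, w, map_sub, map_neg]
    linear_combination (norm := abel) hF' i - hG'
  have h₀ : Tendsto (fun i => ‖v i‖ ^ 2 + ‖w i‖ ^ 2) l (𝓝 0) := by
    simpa using (hv.norm.pow 2).add (hw.norm.pow 2)
  have h₁ := (squeeze_zero (fun i => by positivity) hle h₀).sqrt
  simpa [Real.sqrt_sq] using h₁

end BoundedTransform

/-! ### Kaplansky density and uniqueness of normal extensions. -/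

section Uniqueness

variable {B : Type*} [NonUnitalCStarAlgebra B]
variable {H : Type*} [NormedAddCommGroup H] [InnerProductSpace ℂ H] [CompleteSpace H]
variable {π : B →⋆ₙₐ[ℂ] (H →L[ℂ] H)} {Ω : H}

/-- A Kaplansky density theorem: the bounded transform of a selfadjoint element of the bicommutant
is a strong limit of images of elements of norm at most one. -/
theorem exists_filter_boundedTransform (hnd : ∀ ζ : H, (∀ b, π b ζ = 0) → ζ = 0)
    {X G : H →L[ℂ] H} (hX : X ∈ piBicommutant π) (hX' : IsSelfAdjoint X)
    (hG : G + X * X * G = X + X) {D : Set B} (hDf : ∀ d ∈ D, IsSelfAdjoint d →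
      ∃ f ∈ D, ‖f‖ ≤ 1 ∧ f + d * d * f = d + d)
    (hD : ∀ b, IsSelfAdjoint b → ∀ ε : ℝ, 0 < ε → ∃ d ∈ D, IsSelfAdjoint d ∧ ‖d - b‖ < ε) :
    ∃ l : Filter B, l.NeBot ∧ (∀ᶠ f in l, f ∈ D ∧ ‖f‖ ≤ 1) ∧
      ∀ ξ, Tendsto (fun f => π f ξ) l (𝓝 (G ξ)) := by
  obtain ⟨l, hl, hlim⟩ := exists_filter_isSelfAdjoint_tendsto hnd hX hX' hD
  -- The approximants d of X may be unbounded; their bounded transforms stay in D and in the unit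
  -- ball.
  choose f hfD hf₁ hf₂ using fun d : {d : B // d ∈ D ∧ IsSelfAdjoint d} => hDf d d.2.1 d.2.2
  refine ⟨l.map f, inferInstance, ?_, fun ξ => ?_⟩
  · rw [eventually_map]
    exact Eventually.of_forall fun d => ⟨hfD d, hf₁ d⟩
  · rw [tendsto_map'_iff]
    refine tendsto_boundedTransform (y := fun d : {d : B // d ∈ D ∧ IsSelfAdjoint d} => π d)
      (F := fun d => π (f d)) (fun d => ?_) (fun d => ?_) hG hlim ξ
    · exact d.2.2.map π
    · have := congrArg π (hf₂ d)
      simpa only [map_add, map_mul] using this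

theorem IsNormalMap.sub {M : VonNeumannAlgebra H} {S : Submodule ℂ (H →L[ℂ] H)}
    {Φ Ψ : M.toStarSubalgebra →ₗ[ℂ] S} (hΦ : IsNormalMap M Φ) (hΨ : IsNormalMap M Ψ) :
    IsNormalMap M (Φ - Ψ) := fun l X hr hl ξ η => by
  have := (hΦ l X hr hl ξ η).sub (hΨ l X hr hl ξ η)
  simpa only [LinearMap.sub_apply, Submodule.coe_sub, _root_.sub_apply, inner_sub_right] using this

/-- A normal map on the bicommutant is determined by its values on the image of `π`. -/
theorem IsNormalMap.eq_zero (hnd : ∀ ζ : H, (∀ b, π b ζ = 0) → ζ = 0)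
    {S : Submodule ℂ (H →L[ℂ] H)} {Φ : (piBicommutant π).toStarSubalgebra →ₗ[ℂ] S}
    (hΦ : IsNormalMap (piBicommutant π) Φ)
    (h : ∀ b, Φ ⟨π b, map_mem_piBicommutant b⟩ = 0) : Φ = 0 := by
  have key : ∀ (l : Filter (piBicommutant π).toStarSubalgebra) (X : (piBicommutant π).toStarSubalgebra), l.NeBot →
      (∃ r : ℝ, ∀ᶠ Y : (piBicommutant π).toStarSubalgebra in l, ‖(Y : H →L[ℂ] H)‖ ≤ r) →
      (∀ ξ : H, Tendsto (fun Y : (piBicommutant π).toStarSubalgebra => (Y : H →L[ℂ] H) ξ) l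
        (𝓝 ((X : H →L[ℂ] H) ξ))) → (∀ᶠ Y in l, Φ Y = 0) → Φ X = 0 := by
    intro l X hl hr hlim h₀
    refine Subtype.ext (ContinuousLinearMap.ext fun η => ext_inner_left ℂ fun ξ => ?_)
    refine tendsto_nhds_unique (hΦ l X hr (fun ξ η => tendsto_const_nhds.inner (hlim η)) ξ η) ?_
    refine tendsto_const_nhds.congr' ?_
    filter_upwards [h₀] with Y hY
    rw [hY]
  -- Normality speaks only of bounded nets, so bounded transforms, which Kaplansky density reaches,
  -- are treated first.
  have hsa : ∀ X : (piBicommutant π).toStarSubalgebra, IsSelfAdjoint (X : H →L[ℂ] H) →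
      ∀ G (hG : G ∈ piBicommutant π), G + (X : H →L[ℂ] H) * X * G = X + X → Φ ⟨G, hG⟩ = 0 := by
    intro X hX G hG hXG
    obtain ⟨l, hl, hl₁, hlim⟩ := exists_filter_boundedTransform hnd X.2 hX hXG (D := Set.univ)
      (fun d _ hd => by
        obtain ⟨f, hf₁, hf₂, -⟩ := exists_boundedTransform hd
        exact ⟨f, trivial, hf₁, hf₂⟩) (fun b hb ε hε => ⟨b, trivial, hb, by simpa using hε⟩)
    refine key (l.map fun f => ⟨π f, map_mem_piBicommutant f⟩) _ inferInstance ⟨1, ?_⟩ ?_ ?_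
    · rw [eventually_map]
      filter_upwards [hl₁] with f hf
      exact (NonUnitalStarAlgHom.norm_apply_le π f).trans hf.2
    · exact fun ξ => tendsto_map'_iff.2 (hlim ξ)
    · rw [eventually_map]
      exact Eventually.of_forall h
  have hsa' : ∀ X : (piBicommutant π).toStarSubalgebra, IsSelfAdjoint (X : H →L[ℂ] H) →
      Φ X = 0 := by
    intro X hX
    have hc : ∀ n : ℕ, IsSelfAdjoint ((((n : ℝ) + 1)⁻¹ : ℝ) • (X : H →L[ℂ] H)) := fun n =>
      (IsSelfAdjoint.all _).smul hX
    have hmem : ∀ n : ℕ, (((n : ℝ) + 1)⁻¹ : ℝ) • (X : H →L[ℂ] H) ∈ piBicommutant π := fun n => by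
      rw [← Complex.coe_smul]
      exact (piBicommutant π).toStarSubalgebra.smul_mem X.2 _
    choose G hG₁ hG₂ hG₃ using fun n => exists_boundedTransform (hc n)
    have hGm : ∀ n, G n ∈ piBicommutant π := fun n => mem_piBicommutant.2 fun a ha =>
      (hG₃ n a (mem_piBicommutant.1 (hmem n) a ha).symm).symm
    have hΦG : ∀ n, Φ ⟨G n, hGm n⟩ = 0 := fun n => hsa ⟨_, hmem n⟩ (hc n) _ (hGm n) (hG₂ n)
    -- With ε = 1/(n+1), the bounded transform of εX divided by 2ε is X/(1+ε²X²), which tends to X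
    -- in norm.
    let Y : ℕ → (piBicommutant π).toStarSubalgebra := fun n =>
      (((n + 1) / 2 : ℝ) : ℂ) • ⟨G n, hGm n⟩
    have hY : ∀ n, ‖(Y n : H →L[ℂ] H) - X‖ ≤ ‖(X : H →L[ℂ] H)‖ ^ 2 * (1 / ((n : ℝ) + 1)) := by
      intro n
      have hn : (0 : ℝ) < n + 1 := by positivity
      have h₁ : (Y n : H →L[ℂ] H) - X =
          -((1 / (2 * ((n : ℝ) + 1)) : ℝ) • ((X : H →L[ℂ] H) * X * G n)) := by
        have h₂ : (Y n : H →L[ℂ] H) = (((n : ℝ) + 1) / 2) • G n := by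
          rw [← Complex.coe_smul]
          simp [Y]
        have h₄ := hG₂ n
        rw [smul_mul_smul_comm, smul_mul_assoc] at h₄
        rw [h₂]
        generalize (X : H →L[ℂ] H) * X * G n = Z at h₄ ⊢
        rw [eq_sub_of_add_eq h₄, ← two_smul ℝ, smul_sub, smul_smul, smul_smul, smul_smul,
          show ((n : ℝ) + 1) / 2 * 2 * ((n : ℝ) + 1)⁻¹ = 1 by field_simp, one_smul,
          show ((n : ℝ) + 1) / 2 * (((n : ℝ) + 1)⁻¹ * ((n : ℝ) + 1)⁻¹) =
            1 / (2 * ((n : ℝ) + 1)) by field_simp]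
        abel
      have h₃ : ‖(X : H →L[ℂ] H) * X * G n‖ ≤ ‖(X : H →L[ℂ] H)‖ ^ 2 := by
        refine (norm_mul_le _ _).trans ((mul_le_of_le_one_right (norm_nonneg _) (hG₁ n)).trans ?_)
        rw [pow_two]
        exact norm_mul_le _ _
      rw [h₁, norm_neg, norm_smul, mul_comm, Real.norm_of_nonneg (by positivity)]
      refine mul_le_mul h₃ ?_ (by positivity) (by positivity)
      exact one_div_le_one_div_of_le hn (by linarith)
    have hYlim : Tendsto (fun n => (Y n : H →L[ℂ] H)) atTop (𝓝 X) := by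
      rw [tendsto_iff_norm_sub_tendsto_zero]
      refine squeeze_zero (fun n => norm_nonneg _) hY ?_
      simpa using tendsto_one_div_add_atTop_nhds_zero_nat.const_mul (‖(X : H →L[ℂ] H)‖ ^ 2)
    refine key (atTop.map Y) X inferInstance ⟨‖(X : H →L[ℂ] H)‖ + 1, ?_⟩ (fun ξ => ?_) ?_
    · rw [eventually_map]
      exact (hYlim.norm.eventually_lt_const (lt_add_one _)).mono fun n hn => hn.le
    · exact tendsto_map'_iff.2 (((ContinuousLinearMap.apply ℂ H ξ).continuous.tendsto _).comp hYlim)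
    · rw [eventually_map]
      refine Eventually.of_forall fun n => ?_
      rw [map_smul, hΦG, smul_zero]
  ext1 X
  have h₁ : X = (2⁻¹ : ℂ) • (X + star X) + (2⁻¹ * Complex.I) • (-Complex.I • (X - star X)) := by
    rw [smul_smul, show 2⁻¹ * Complex.I * -Complex.I = 2⁻¹ by
      rw [mul_assoc, mul_neg, Complex.I_mul_I]; norm_num, ← smul_add,
      show X + star X + (X - star X) = (2 : ℂ) • X by rw [two_smul]; abel, smul_smul]
    norm_num
  rw [h₁, map_add, map_smul, map_smul, hsa', hsa']
  · simp
  · have : star (-Complex.I • (X - star X)) = -Complex.I • (X - star X) := by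
      rw [star_smul, star_sub, star_star]
      simp [← smul_neg]
    exact congrArg Subtype.val this
  · exact congrArg Subtype.val (IsSelfAdjoint.add_star_self X).star_eq

end Uniqueness

/-! ### Pure states, dominated functionals and irreducibility. -/

section PureStates

variable {B : Type*} [NonUnitalCStarAlgebra B]
variable {H : Type*} [NormedAddCommGroup H] [InnerProductSpace ℂ H] [CompleteSpace H]

open ContinuousLinearMap (adjoint)

/-- The values of a positive functional on an approximate unit converge to its norm. -/
theorem tendsto_norm_of_positive {ω : B →L[ℂ] ℂ} (hω : ∀ b, 0 ≤ ω (star b * b)) {l : Filter B}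
    (hl₁ : ∀ᶠ e in l, ‖e‖ ≤ 1) (hl₂ : ∀ b : B, Tendsto (fun e => e * b) l (𝓝 b)) :
    Tendsto (fun e => ω e) l (𝓝 (‖ω‖ : ℂ)) := by
  obtain ⟨E, _, _, _, ρ, ξ, h⟩ := exists_isGNSTriple hω
  have h₁ : Tendsto (fun e => ⟪ξ, ρ e ξ⟫_ℂ) l (𝓝 ⟪ξ, ξ⟫_ℂ) :=
    tendsto_const_nhds.inner (h.tendsto_approximateUnit hl₁ hl₂ ξ)
  simp only [h.inner_eq] at h₁
  rw [inner_self_eq_norm_sq_to_K] at h₁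
  rw [← h.norm_sq]
  exact_mod_cast h₁

/-- All three norms are limits along one approximate unit. Additivity makes the weights ‖ω‖ and ‖ψ -
ω‖ sum to one when a state is split. -/
theorem norm_add_of_positive {ω ω' : B →L[ℂ] ℂ} (hω : ∀ b, 0 ≤ ω (star b * b))
    (hω' : ∀ b, 0 ≤ ω' (star b * b)) : ‖ω + ω'‖ = ‖ω‖ + ‖ω'‖ := by
  obtain ⟨l, hl, hl₁, hl₂⟩ := exists_approximateUnit B
  have h₁ := tendsto_norm_of_positive (ω := ω + ω') (fun b => add_nonneg (hω b) (hω' b)) hl₁ hl₂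
  have h₂ := (tendsto_norm_of_positive hω hl₁ hl₂).add (tendsto_norm_of_positive hω' hl₁ hl₂)
  exact_mod_cast tendsto_nhds_unique h₁ h₂

theorem eq_zero_of_forall_star_mul_self {ω : B →L[ℂ] ℂ} (hω : ∀ b, ω (star b * b) = 0) :
    ω = 0 := by
  obtain ⟨E, _, _, _, ρ, ξ, h⟩ := exists_isGNSTriple fun b => (hω b).ge
  ext b
  have : ρ b ξ = 0 := inner_self_eq_zero.1 ((h.inner_apply b b).trans (hω b))
  rw [← h.inner_eq, this, inner_zero_right]
  rfl

/-- A state is pure if all positive functionals below it are multiples of it. -/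
theorem isPureState_of_forall_le {ψ : B →L[ℂ] ℂ} (hψ : ψ ∈ stateSpace B)
    (h : ∀ ω : B →L[ℂ] ℂ, (∀ b, 0 ≤ ω (star b * b)) → (∀ b, ω (star b * b) ≤ ψ (star b * b)) →
      ∃ z : ℂ, ω = z • ψ) : IsPureState ψ := by
  refine mem_extremePoints_iff_left.2 ⟨hψ, fun ω hω ω' hω' hseg => ?_⟩
  obtain ⟨r, r', hr, hr', hrr, hsum⟩ := hseg
  have hpos : ∀ (c : ℝ) (φ : B →L[ℂ] ℂ), 0 < c → φ ∈ stateSpace B → ∀ b,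
      0 ≤ (c • φ) (star b * b) := fun c φ hc hφ b => smul_nonneg hc.le (hφ.1 b)
  obtain ⟨z, hz⟩ := h (r • ω) (hpos r ω hr hω) fun b => by
    rw [← hsum]
    exact le_add_of_nonneg_right (hpos r' ω' hr' hω' b)
  have hz' : ω = ((r⁻¹ : ℝ) * z) • ψ := by
    ext b
    have hb : (r : ℂ) * ω b = z * ψ b := congrArg (· b) hz
    change ω b = (r⁻¹ : ℝ) * z * ψ b
    rw [mul_assoc, ← hb, ← mul_assoc, ← Complex.ofReal_mul, inv_mul_cancel₀ hr.ne',
      Complex.ofReal_one, one_mul]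
  set w : ℂ := (r⁻¹ : ℝ) * z
  -- Evaluating here shows that the multiplier w is nonnegative; comparison of norms then gives w =
  -- 1.
  obtain ⟨b, hb⟩ : ∃ b, ψ (star b * b) ≠ 0 := by
    by_contra! h₀
    have := hψ.2
    rw [eq_zero_of_forall_star_mul_self h₀, norm_zero] at this
    exact zero_ne_one this
  have hw : 0 ≤ w := by
    have h₁ : ω (star b * b) = w * ψ (star b * b) := congrArg (· (star b * b)) hz'
    have h₂ : w = ω (star b * b) / ψ (star b * b) := by rw [h₁, mul_div_cancel_right₀ _ hb]
    rw [h₂]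
    have hi : 0 ≤ (ψ (star b * b))⁻¹ := inv_nonneg_of_nonneg (hψ.1 b)
    exact mul_nonneg (hω.1 b) hi
  have hw' : ‖w‖ = 1 := by
    have := hω.2
    rwa [hz', norm_smul, hψ.2, mul_one] at this
  have : w = 1 := by
    rw [← Complex.norm_of_nonneg' hw, hw']
    rfl
  rw [hz', this, one_smul]

/-- The positive functionals below a pure state are multiples of it. -/
theorem IsPureState.exists_eq_smul {ψ ω : B →L[ℂ] ℂ} (hψ : IsPureState ψ)
    (hω : ∀ b, 0 ≤ ω (star b * b)) (hle : ∀ b, ω (star b * b) ≤ ψ (star b * b)) :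
    ∃ r : ℝ, ω = r • ψ := by
  have hω' : ∀ b, 0 ≤ (ψ - ω) (star b * b) := fun b => sub_nonneg.2 (hle b)
  have hsum : ‖ω‖ + ‖ψ - ω‖ = 1 := by
    rw [← norm_add_of_positive hω hω', add_sub_cancel, hψ.1.2]
  -- If ω or ψ - ω vanishes it cannot be normalized to a state, so these cases are separated.
  rcases eq_or_ne ‖ω‖ 0 with h₀ | h₀
  · exact ⟨0, (norm_eq_zero.1 h₀).trans (zero_smul ℝ ψ).symm⟩
  rcases eq_or_ne ‖ψ - ω‖ 0 with h₁ | h₁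
  · exact ⟨1, by rw [one_smul, eq_of_sub_eq_zero (norm_eq_zero.1 h₁)]⟩
  have hstate : ∀ φ : B →L[ℂ] ℂ, (∀ b, 0 ≤ φ (star b * b)) → ‖φ‖ ≠ 0 →
      ‖φ‖⁻¹ • φ ∈ stateSpace B := fun φ hφ hn =>
    ⟨fun b => smul_nonneg (inv_nonneg.2 (norm_nonneg _)) (hφ b), by
      rw [norm_smul, norm_inv, norm_norm, inv_mul_cancel₀ hn]⟩
  have := (mem_extremePoints_iff_left.1 hψ).2 _ (hstate ω hω h₀) _ (hstate _ hω' h₁)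
    ⟨‖ω‖, ‖ψ - ω‖, (norm_nonneg _).lt_of_ne' h₀, (norm_nonneg _).lt_of_ne' h₁, hsum, by
      rw [smul_smul, smul_smul, mul_inv_cancel₀ h₀, mul_inv_cancel₀ h₁, one_smul, one_smul,
        add_sub_cancel]⟩
  exact ⟨‖ω‖, by rw [← this, smul_smul, mul_inv_cancel₀ h₀, one_smul]⟩

variable {ψ : B →L[ℂ] ℂ} {π : B →⋆ₙₐ[ℂ] (H →L[ℂ] H)} {Ω : H}

/-- The GNS representation of a pure state is irreducible. -/
theorem IsGNSTriple.exists_eq_smul_one (h : IsGNSTriple ψ π Ω) (hψ : IsPureState ψ)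
    {a : H →L[ℂ] H} (ha : a ∈ piCommutant π) : ∃ z : ℂ, a = z • 1 := by
  have h₁ : ∀ x ∈ piCommutant π, ‖x‖ ≤ 1 → ∃ z : ℂ, star x * x = z • 1 := by
    intro x hx hx₁
    have hxx : star x * x ∈ piCommutant π := mul_mem (star_mem hx) hx
    -- For a contraction x in the commutant this functional is dominated by ψ, so purity makes it a
    -- multiple of ψ and x*x a scalar.
    let ω : B →L[ℂ] ℂ := LinearMap.mkContinuous
      { toFun := fun b => ⟪x Ω, x (π b Ω)⟫_ℂ
        map_add' := fun a b => by simp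
        map_smul' := fun c b => by simp } (‖Ω‖ * ‖Ω‖) fun b => by
      refine (norm_inner_le_norm _ _).trans ?_
      have hle : ∀ y, ‖x y‖ ≤ ‖y‖ := fun y =>
        (x.le_of_opNorm_le hx₁ y).trans_eq (one_mul _)
      rw [mul_assoc, mul_comm ‖Ω‖ ‖b‖]
      exact mul_le_mul (hle Ω) ((hle _).trans (norm_map_apply_le π b Ω)) (norm_nonneg _)
        (norm_nonneg _)
    have hω : ∀ b, ω b = ⟪x Ω, x (π b Ω)⟫_ℂ := fun _ => rfl
    have hωb : ∀ b, ω (star b * b) = ((‖x (π b Ω)‖ ^ 2 : ℝ) : ℂ) := fun b => by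
      rw [hω, map_mul_apply, ← mem_piCommutant_iff_apply.1 hx, inner_map_star,
        mem_piCommutant_iff_apply.1 hx, inner_self_eq_norm_sq_to_K]
      norm_cast
    have hψb : ∀ b, ψ (star b * b) = ((‖π b Ω‖ ^ 2 : ℝ) : ℂ) := fun b => by
      rw [← h.inner_apply, inner_self_eq_norm_sq_to_K]
      norm_cast
    obtain ⟨r, hr⟩ := hψ.exists_eq_smul (ω := ω)
      (fun b => by rw [hωb]; exact Complex.zero_le_real.2 (sq_nonneg _))
      (fun b => by
        rw [hωb, hψb]
        have : ‖x (π b Ω)‖ ≤ ‖π b Ω‖ := (x.le_of_opNorm_le hx₁ _).trans_eq (one_mul _)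
        exact_mod_cast pow_le_pow_left₀ (norm_nonneg _) this 2)
    have h₂ : (star x * x) Ω = (r : ℂ) • Ω := h.eq_of_inner fun b => by
      have h₃ := congrArg (· b) hr
      change ω b = r • ψ b at h₃
      rw [hω, ← h.inner_eq, ← inner_star_apply] at h₃
      rw [inner_smul_left, Complex.conj_ofReal, ← inner_star_apply, star_mul, star_star]
      exact h₃
    refine ⟨r, h.ext_operator fun b => ?_⟩
    rw [← mem_piCommutant_iff_apply.1 hxx, h₂, map_smul]
    rfl
  have h₂ : ∀ x ∈ piCommutant π, ∃ z : ℂ, star x * x = z • 1 := by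
    intro x hx
    have hr : (0 : ℝ) < ‖x‖ + 1 := by positivity
    obtain ⟨z, hz⟩ := h₁ (((‖x‖ + 1 : ℝ)⁻¹ : ℂ) • x)
      ((piCommutant π).toStarSubalgebra.smul_mem hx _) (by
        rw [norm_smul, norm_inv, Complex.norm_of_nonneg hr.le, inv_mul_le_one₀ hr]
        exact (lt_add_one _).le)
    refine ⟨(‖x‖ + 1 : ℝ) * ((‖x‖ + 1 : ℝ) * z), ?_⟩
    have hr' : ((‖x‖ + 1 : ℝ) : ℂ) ≠ 0 := by exact_mod_cast hr.ne'
    rw [mul_smul, mul_smul, ← hz, star_smul, smul_mul_smul_comm, smul_smul, smul_smul, star_inv₀,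
      Complex.star_def, Complex.conj_ofReal]
    field_simp
    rw [one_smul]
  obtain ⟨z, hz⟩ := h₂ a ha
  obtain ⟨z₁, hz₁⟩ := h₂ (1 + a) (add_mem (one_mem _) ha)
  obtain ⟨z₂, hz₂⟩ := h₂ (1 + Complex.I • a)
    (add_mem (one_mem _) ((piCommutant π).toStarSubalgebra.smul_mem ha _))
  -- Polarization: expanding x*x for x = 1 + a and x = 1 + ia shows that a + a* and i(a - a*) are
  -- scalars.
  refine ⟨2⁻¹ * ((z₁ - 1 - z) - Complex.I * (z₂ - 1 - z)), ?_⟩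
  have h₃ : star a + a = (z₁ - 1 - z) • (1 : H →L[ℂ] H) := by
    rw [sub_smul, sub_smul, ← hz₁, ← hz, one_smul, star_add, star_one]
    noncomm_ring
  have h₄ : Complex.I • (a - star a) = (z₂ - 1 - z) • (1 : H →L[ℂ] H) := by
    rw [sub_smul, sub_smul, ← hz₂, ← hz, one_smul, star_add, star_one, star_smul,
      Complex.star_def, Complex.conj_I, mul_add, add_mul, add_mul, smul_mul_smul_comm, neg_mul,
      Complex.I_mul_I, neg_neg, one_smul, mul_one, mul_one, one_mul]
    module
  rw [mul_smul, sub_smul, mul_smul, ← h₃, ← h₄, smul_smul, Complex.I_mul_I]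
  module

/-- A positive functional below a state is implemented by an operator in the commutant of the
GNS representation. -/
theorem IsGNSTriple.exists_commutant_of_le (h : IsGNSTriple ψ π Ω) {ω : B →L[ℂ] ℂ}
    (hω : ∀ b, 0 ≤ ω (star b * b)) (hle : ∀ b, ω (star b * b) ≤ ψ (star b * b)) :
    ∃ a ∈ piCommutant π, ‖a‖ ≤ 1 ∧ ∀ b, ω b = ⟪Ω, a (π b Ω)⟫_ℂ := by
  obtain ⟨E, _, _, _, ρ, ξ, hρ⟩ := exists_isGNSTriple hω
  have hn : ∀ b, ‖orbitMap ρ ξ b‖ ≤ 1 * ‖orbitMap π Ω b‖ := fun b => by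
    have h₁ := hle b
    rw [← h.inner_apply, ← hρ.inner_apply, inner_self_eq_norm_sq_to_K,
      inner_self_eq_norm_sq_to_K] at h₁
    rw [one_mul]
    exact (sq_le_sq₀ (norm_nonneg _) (norm_nonneg _)).1 (by exact_mod_cast h₁)
  -- Domination makes π(b)Ω ↦ ρ(b)ξ a contraction between the two GNS spaces; the required operator
  -- is W*W.
  set W := (orbitMap ρ ξ).extendOfNorm (orbitMap π Ω)
  have hW : ∀ b, W (π b Ω) = ρ b ξ := LinearMap.extendOfNorm_eq h.denseRange ⟨1, hn⟩
  have hW₁ : ‖W‖ ≤ 1 := LinearMap.opNorm_extendOfNorm_le h.denseRange zero_le_one hn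
  have hcomm : ∀ b x, W (π b x) = ρ b (W x) := fun b x => by
    have : W ∘L π b = ρ b ∘L W := h.ext_operator fun c => by
      change W (π b (π c Ω)) = ρ b (W (π c Ω))
      rw [hW, ← map_mul_apply, hW, map_mul_apply]
    exact congrArg (· x) this
  -- Without a unit Ω need not be of the form π(b)Ω, so this relies on nondegeneracy of ρ.
  have hΩ : W Ω = ξ := eq_of_sub_eq_zero <| hρ.eq_zero_of_forall_apply_eq_zero fun b => by
    rw [map_sub, ← hcomm, hW, sub_self]
  refine ⟨adjoint W ∘L W, mem_piCommutant_iff_apply.2 fun b x => ?_, ?_, fun b => ?_⟩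
  · change π b (adjoint W (W x)) = adjoint W (W (π b x))
    rw [hcomm, adjoint_comm_of_comm hcomm]
  · refine (ContinuousLinearMap.opNorm_comp_le _ _).trans ?_
    rw [LinearIsometryEquiv.norm_map]
    exact mul_le_one₀ hW₁ (norm_nonneg _) hW₁
  · rw [ContinuousLinearMap.comp_apply, ContinuousLinearMap.adjoint_inner_right, hΩ, hW,
      hρ.inner_eq]

end PureStates

/-! ### The compressed dynamics through implementing isometries. -/

section Compress

variable {B : Type*} [NonUnitalCStarAlgebra B]
variable {H : Type*} [NormedAddCommGroup H] [InnerProductSpace ℂ H] [CompleteSpace H]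
variable {ψ : B →L[ℂ] ℂ} {π : B →⋆ₙₐ[ℂ] (H →L[ℂ] H)} {Ω : H}
  {α : B →⋆ₙₐ[ℂ] B} {V : H →L[ℂ] H}

theorem IsCompressedExtension.unique (hnd : ∀ ζ : H, (∀ b, π b ζ = 0) → ζ = 0)
    {Φ Ψ : (piBicommutant π).toStarSubalgebra →ₗ[ℂ] corner π Ω}
    (hΦ : IsCompressedExtension π Ω α Φ) (hΨ : IsCompressedExtension π Ω α Ψ) : Φ = Ψ := by
  refine eq_of_sub_eq_zero ((hΦ.1.sub hΨ.1).eq_zero hnd fun b => ?_)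
  rw [LinearMap.sub_apply, sub_eq_zero]
  exact Subtype.ext ((hΦ.2 b _).trans (hΨ.2 b _).symm)

/-- By uniqueness the arbitrary choice in `compressedExtension` is immaterial, so the explicit
extension built from V may be used instead. -/
theorem compressedExtension_eq (hnd : ∀ ζ : H, (∀ b, π b ζ = 0) → ζ = 0)
    {Φ : (piBicommutant π).toStarSubalgebra →ₗ[ℂ] corner π Ω}
    (hΦ : IsCompressedExtension π Ω α Φ) : compressedExtension π Ω α = Φ := by
  have h : ∃ Φ, IsCompressedExtension π Ω α Φ := ⟨Φ, hΦ⟩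
  rw [compressedExtension, dif_pos h]
  exact h.choose_spec.unique hnd hΦ

theorem compress_apply (hnd : ∀ ζ : H, (∀ b, π b ζ = 0) → ζ = 0)
    (hV : IsIntertwiningIsometry π Ω (π.comp α) Ω V) (x : corner π Ω) :
    (compress π Ω α x : H →L[ℂ] H) Ω = supportProj π Ω (V ((x : H →L[ℂ] H) Ω)) := by
  obtain ⟨Φ, hΦ, h, -⟩ := exists_isCompressedExtension hV
  rw [compress, compressedExtension_eq hnd hΦ, h]

theorem star_compress_apply (hnd : ∀ ζ : H, (∀ b, π b ζ = 0) → ζ = 0)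
    (hV : IsIntertwiningIsometry π Ω (π.comp α) Ω V) (x : corner π Ω) :
    star (compress π Ω α x : H →L[ℂ] H) Ω =
      supportProj π Ω (V (star (x : H →L[ℂ] H) Ω)) := by
  obtain ⟨Φ, hΦ, h, h'⟩ := exists_isCompressedExtension hV
  rw [compress, compressedExtension_eq hnd hΦ, ← h', h]
  rfl

theorem apply_supportProj_of_mem_corner {c : H →L[ℂ] H} (hc : c ∈ corner π Ω) (x : H) :
    c (supportProj π Ω x) = c x :=
  congrArg (· x) (mem_corner_iff.1 hc).2.2

/-- The correlations in the weak Kolmogorov property in terms of the implementing isometry. -/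
theorem vectorState_compress (hnd : ∀ ζ : H, (∀ b, π b ζ = 0) → ζ = 0)
    (hV : IsIntertwiningIsometry π Ω (π.comp α) Ω V) {c : H →L[ℂ] H} (hc : c ∈ corner π Ω)
    (x y : corner π Ω) :
    vectorState Ω ((compress π Ω α x : H →L[ℂ] H) * star c * c *
      (compress π Ω α y : H →L[ℂ] H)) =
      ⟪c (V (star (x : H →L[ℂ] H) Ω)), c (V ((y : H →L[ℂ] H) Ω))⟫_ℂ := by
  have h₁ := star_compress_apply hnd hV x
  have h₂ := compress_apply hnd hV y
  change ⟪Ω, (compress π Ω α x : H →L[ℂ] H) (star c (c ((compress π Ω α y : H →L[ℂ] H) Ω)))⟫_ℂ = _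
  rw [h₂, ← star_star (compress π Ω α x : H →L[ℂ] H), inner_star_apply, h₁, inner_star_apply,
    apply_supportProj_of_mem_corner hc, apply_supportProj_of_mem_corner hc]

theorem inner_star_apply_left (a : H →L[ℂ] H) (ξ η : H) : ⟪star a ξ, η⟫_ℂ = ⟪ξ, a η⟫_ℂ := by
  rw [← inner_star_apply, star_star]

end Compress

/-! ### The limit state, and purity from the weak Kolmogorov property. -/

section Limit

variable {T : Type*} [AddCommGroup T] [LinearOrder T] [IsOrderedAddMonoid T]
variable {B : Type*} [NonUnitalCStarAlgebra B]
variable {lam : {t : T // 0 ≤ t} → (B →⋆ₙₐ[ℂ] B)} (hlam : IsInjectiveSemigroup lam)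

open InductiveLimit

/-- Here u ≥ 0 labels the subalgebra at time -u, so the ranges increase with u. -/
theorem emb_add (u r : {t : T // 0 ≤ t}) (b : B) :
    emb hlam (-((u + r : {t : T // 0 ≤ t}) : T)) (lam r b) = emb hlam (-(u : T)) b := by
  rw [← (isInductiveLimit hlam).compatible]
  congr 2
  simp

/-- The embeddings at nonpositive times exhaust the inductive limit. -/
theorem dense_iUnion_range_emb :
    Dense (⋃ u : {t : T // 0 ≤ t}, Set.range (emb hlam (-(u : T)))) := by
  refine (isInductiveLimit hlam).dense.mono ?_
  refine Set.iUnion_subset fun t => ?_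
  rintro _ ⟨b, rfl⟩
  let u : {t : T // 0 ≤ t} := ⟨max (-t) 0, le_max_right _ _⟩
  have hu : 0 ≤ t + (u : T) := by
    have : -t ≤ (u : T) := le_max_left _ _
    rw [add_comm]
    exact neg_le_iff_add_nonneg.1 this
  refine Set.mem_iUnion.2 ⟨u, lam ⟨t + u, hu⟩ b, ?_⟩
  rw [← (isInductiveLimit hlam).compatible]
  congr 2
  change -(u : T) + (t + u) = t
  abel

theorem continuous_emb (t : T) : Continuous (emb hlam t) :=
  AddMonoidHomClass.continuous_of_bound (emb hlam t) 1 fun b => by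
    rw [one_mul]
    exact NonUnitalStarAlgHom.norm_apply_le _ b

theorem inductiveLimit_induction {p : InductiveLimit hlam → Prop} (hp : IsClosed {x | p x})
    (h : ∀ (u : {t : T // 0 ≤ t}) b, p (emb hlam (-(u : T)) b)) (x : InductiveLimit hlam) : p x := by
  refine (dense_iUnion_range_emb hlam).induction (P := p) ?_ hp x
  rintro _ ⟨_, ⟨u, rfl⟩, b, rfl⟩
  exact h u b

theorem inductiveLimit_functional_ext {ω ω' : InductiveLimit hlam →L[ℂ] ℂ}
    (h : ∀ (u : {t : T // 0 ≤ t}) b, ω (emb hlam (-(u : T)) b) = ω' (emb hlam (-(u : T)) b)) :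
    ω = ω' :=
  ContinuousLinearMap.ext <| inductiveLimit_induction hlam
    (isClosed_eq ω.continuous ω'.continuous) h

theorem limitState_mem_stateSpace {ψ : B →L[ℂ] ℂ} (hψ : ψ ∈ stateSpace B)
    (hinv : ∀ t b, ψ (lam t b) = ψ b) : limitState hlam ψ hinv ∈ stateSpace (InductiveLimit hlam) := by
  refine ⟨inductiveLimit_induction hlam ?_ fun u b => ?_, le_antisymm ?_ ?_⟩
  · exact isClosed_le continuous_const ((ContinuousLinearMap.continuous _).comp
      (continuous_star.mul continuous_id))
  · rw [← map_star, ← map_mul, limitState_emb]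
    exact hψ.1 b
  · refine ContinuousLinearMap.opNorm_le_bound _ zero_le_one
      (inductiveLimit_induction hlam ?_ fun u b => ?_)
    · exact isClosed_le (ContinuousLinearMap.continuous _).norm (by fun_prop)
    · rw [limitState_emb, one_mul,
        NonUnitalStarAlgHom.norm_map _ ((isInductiveLimit hlam).injective _), ← one_mul ‖b‖, ← hψ.2]
      exact ψ.le_opNorm b
  · rw [← hψ.2]
    refine ContinuousLinearMap.opNorm_le_bound _ (norm_nonneg _) fun b => ?_
    rw [← limitState_emb ψ hinv 0 b,
      ← NonUnitalStarAlgHom.norm_map _ ((isInductiveLimit hlam).injective 0) b]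
    exact ContinuousLinearMap.le_opNorm _ _

variable {H : Type*} [NormedAddCommGroup H] [InnerProductSpace ℂ H] [CompleteSpace H]
variable {ψ : B →L[ℂ] ℂ} {π : B →⋆ₙₐ[ℂ] (H →L[ℂ] H)} {Ω : H}

/-- By invariance Ω induces the same functional ψ through π∘λ_t as through π. -/
theorem IsGNSTriple.exists_implementing (h : IsGNSTriple ψ π Ω)
    (hinv : ∀ t b, ψ (lam t b) = ψ b) : ∃ V : {t : T // 0 ≤ t} → (H →L[ℂ] H),
      ∀ t, IsIntertwiningIsometry π Ω (π.comp (lam t)) Ω (V t) := by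
  choose V hV using fun t : {t : T // 0 ≤ t} =>
    h.exists_isIntertwiningIsometry (ρ := π.comp (lam t)) (ξ := Ω)
      (fun b => (h.inner_eq (lam t b)).trans (hinv t b)) rfl
  exact ⟨V, hV⟩

variable {V : {t : T // 0 ≤ t} → (H →L[ℂ] H)}

/-- The weak Kolmogorov property in terms of implementing isometries. -/
theorem isWeaklyKolmogorov_iff (h : IsGNSTriple ψ π Ω)
    (hV : ∀ t, IsIntertwiningIsometry π Ω (π.comp (lam t)) Ω (V t)) :
    IsWeaklyKolmogorov π Ω lam ↔ ∃ c : {t : T // 0 ≤ t} → corner π Ω,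
      (∀ t, ‖(c t : H →L[ℂ] H)‖ ≤ 1) ∧ ∀ (s : {t : T // 0 ≤ t}) (x y : corner π Ω),
        Tendsto (fun t => ⟪(c (s + t) : H →L[ℂ] H) (V t (star (x : H →L[ℂ] H) Ω)),
          (c (s + t) : H →L[ℂ] H) (V t ((y : H →L[ℂ] H) Ω))⟫_ℂ) atTop
          (𝓝 (⟪star (x : H →L[ℂ] H) Ω, Ω⟫_ℂ * ⟪Ω, (y : H →L[ℂ] H) Ω⟫_ℂ)) := by
  have hnd : ∀ ζ : H, (∀ b, π b ζ = 0) → ζ = 0 := fun ζ => h.eq_zero_of_forall_apply_eq_zero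
  refine exists_congr fun c => and_congr_right fun _ => forall_congr' fun s =>
    forall_congr' fun x => forall_congr' fun y => ?_
  simp only [vectorState_compress hnd (hV _) (c _).2, inner_star_apply_left]
  rfl

/-- The square expands to 1 - 2‖cΩ‖² + ‖c*cΩ‖², and the last term is at most ‖cΩ‖². So ‖cΩ‖ near one
forces c*c nearly to fix Ω. -/
theorem norm_sub_star_mul_self_apply_sq_le {c : H →L[ℂ] H} (hc : ‖c‖ ≤ 1) (hΩ : ‖Ω‖ = 1) :
    ‖Ω - star c (c Ω)‖ ^ 2 ≤ 1 - ‖c Ω‖ ^ 2 := by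
  have h₁ : ‖star c (c Ω)‖ ≤ ‖c Ω‖ :=
    ((star c).le_of_opNorm_le ((norm_star c).trans_le hc) _).trans_eq (one_mul _)
  have h₂ : (⟪Ω, star c (c Ω)⟫_ℂ).re = ‖c Ω‖ ^ 2 := by
    rw [inner_star_apply, inner_self_eq_norm_sq_to_K]
    norm_cast
  have h₃ : RCLike.re ⟪Ω, star c (c Ω)⟫_ℂ = ‖c Ω‖ ^ 2 := h₂
  rw [@norm_sub_sq ℂ, h₃, hΩ]
  nlinarith [norm_nonneg (star c (c Ω)), norm_nonneg (c Ω)]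

/-- The weak Kolmogorov property implies purity of the inductive limit state. -/
theorem IsWeaklyKolmogorov.isPureState (hψ : ψ ∈ stateSpace B)
    (hinv : ∀ t b, ψ (lam t b) = ψ b) (h : IsGNSTriple ψ π Ω)
    (hWK : IsWeaklyKolmogorov π Ω lam) : IsPureState (limitState hlam ψ hinv) := by
  obtain ⟨V, hV⟩ := h.exists_implementing hinv
  obtain ⟨c, hc, hlim⟩ := (isWeaklyKolmogorov_iff h hV).1 hWK
  have hΩ : ‖Ω‖ = 1 := h.norm_eq_one hψ
  have hΩ' : ⟪Ω, Ω⟫_ℂ = 1 := by rw [inner_self_eq_norm_sq_to_K, hΩ]; simp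
  have hcΩ : ∀ s : {t : T // 0 ≤ t}, Tendsto (fun t => Ω - star (c (s + t) : H →L[ℂ] H)
      ((c (s + t) : H →L[ℂ] H) Ω)) atTop (𝓝 0) := by
    intro s
    -- Taking x = y = P in (WK) yields ‖cΩ‖ → 1.
    have h₁ := hlim s ⟨_, supportProj_mem_corner⟩ ⟨_, supportProj_mem_corner⟩
    simp only [star_supportProj, supportProj_self, (hV _).map_vec, hΩ',
      inner_self_eq_norm_sq_to_K] at h₁
    have h₂ : Tendsto (fun t => ‖(c (s + t) : H →L[ℂ] H) Ω‖ ^ 2) atTop (𝓝 1) := by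
      have := (Complex.continuous_re.tendsto _).comp h₁
      simpa [Function.comp_def, ← Complex.ofReal_pow] using this
    rw [tendsto_zero_iff_norm_tendsto_zero]
    have h₃ : Tendsto (fun t => 1 - ‖(c (s + t) : H →L[ℂ] H) Ω‖ ^ 2) atTop (𝓝 0) := by
      simpa using h₂.const_sub 1
    have h₄ := (squeeze_zero (fun t => by positivity)
      (fun t => norm_sub_star_mul_self_apply_sq_le (hc (s + t)) hΩ) h₃).sqrt
    simpa [Real.sqrt_sq] using h₄
  have hcV : ∀ (s : {t : T // 0 ≤ t}) (b : B), Tendsto (fun t => (c (s + t) : H →L[ℂ] H)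
      (V t (π b Ω)) - ψ b • (c (s + t) : H →L[ℂ] H) Ω) atTop (𝓝 0) := by
    intro s b
    -- The centred element PbP - ψ(b)P has expectation zero, so (WK) for the pair y*, y makes the
    -- norm of cV_t yΩ tend to zero.
    let y : corner π Ω := ⟨_, compress_mem_corner b⟩ - ψ b • ⟨_, supportProj_mem_corner⟩
    have hy : (y : H →L[ℂ] H) Ω = supportProj π Ω (π b Ω) - ψ b • Ω := by
      change supportProj π Ω (π b (supportProj π Ω Ω)) - ψ b • supportProj π Ω Ω = _
      rw [supportProj_self]
    have hy₀ : ⟪Ω, (y : H →L[ℂ] H) Ω⟫_ℂ = 0 := by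
      rw [hy, inner_sub_right, inner_supportProj, supportProj_self, inner_smul_right, h.inner_eq,
        hΩ', mul_one, sub_self]
    have hcy : ∀ t, (c (s + t) : H →L[ℂ] H) (V t ((y : H →L[ℂ] H) Ω)) =
        (c (s + t) : H →L[ℂ] H) (V t (π b Ω)) - ψ b • (c (s + t) : H →L[ℂ] H) Ω := by
      intro t
      rw [hy, map_sub, map_sub, map_smul, map_smul, (hV t).map_vec,
        ← apply_supportProj_of_mem_corner (c (s + t)).2 (V t (supportProj π Ω _)),
        (hV t).supportProj_apply, apply_supportProj_of_mem_corner (c (s + t)).2]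
    have h₁ := hlim s ⟨star (y : H →L[ℂ] H), star_mem_corner y.2⟩ y
    simp only [star_star, hy₀, mul_zero, hcy, inner_self_eq_norm_sq_to_K] at h₁
    rw [tendsto_zero_iff_norm_tendsto_zero]
    have h₂ := (Complex.continuous_re.tendsto _).comp h₁
    have h₃ : Tendsto (fun t => ‖(c (s + t) : H →L[ℂ] H) (V t (π b Ω)) -
        ψ b • (c (s + t) : H →L[ℂ] H) Ω‖ ^ 2) atTop (𝓝 0) := by
      simpa [Function.comp_def, ← Complex.ofReal_pow] using h₂
    simpa [Real.sqrt_sq] using h₃.sqrt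
  refine isPureState_of_forall_le (limitState_mem_stateSpace hlam hψ hinv) fun ω hω hle => ?_
  have hRN : ∀ u : {t : T // 0 ≤ t}, ∃ a ∈ piCommutant π, ‖a‖ ≤ 1 ∧
      ∀ b, ω (emb hlam (-(u : T)) b) = ⟪Ω, a (π b Ω)⟫_ℂ := by
    intro u
    let e : B →L[ℂ] InductiveLimit hlam :=
      ⟨{ toFun := emb hlam (-(u : T)), map_add' := map_add _, map_smul' := map_smul _ },
        continuous_emb hlam _⟩
    have he : ∀ b, e b = emb hlam (-(u : T)) b := fun _ => rfl
    refine h.exists_commutant_of_le (ω := ω.comp e) (fun b => ?_) fun b => ?_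
    · rw [ContinuousLinearMap.comp_apply, he, map_mul, map_star]
      exact hω _
    · rw [ContinuousLinearMap.comp_apply, he, ← limitState_emb ψ hinv (-(u : T)), map_mul,
        map_star]
      exact hle _
  choose a ha ha₁ hωa using hRN
  have hbdd : ∀ u x, ‖a u x‖ ≤ ‖x‖ := fun u x =>
    ((a u).le_of_opNorm_le (ha₁ u) x).trans_eq (one_mul _)
  have hcbdd : ∀ u x, ‖(c u : H →L[ℂ] H) x‖ ≤ ‖x‖ := fun u x =>
    ((c u : H →L[ℂ] H).le_of_opNorm_le (hc u) x).trans_eq (one_mul _)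
  let m : {t : T // 0 ≤ t} → ℂ := fun u =>
    ⟪(c u : H →L[ℂ] H) Ω, a u ((c u : H →L[ℂ] H) Ω)⟫_ℂ
  have hm : ∀ (s : {t : T // 0 ≤ t}) (b : B),
      Tendsto (fun t => ψ b * m (s + t)) atTop (𝓝 (ω (emb hlam (-(s : T)) b))) := by
    intro s b
    -- The left Ω is replaced by c*cΩ, then c is moved across a_{s+t}, which lies in the commutant,
    -- and finally cV_t π(b)Ω is compared with ψ(b)cΩ.
    have h₁ : ∀ t, ω (emb hlam (-(s : T)) b) - ψ b * m (s + t) =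
        ⟪Ω - star (c (s + t) : H →L[ℂ] H) ((c (s + t) : H →L[ℂ] H) Ω),
          a (s + t) (V t (π b Ω))⟫_ℂ +
        ⟪(c (s + t) : H →L[ℂ] H) Ω, a (s + t) ((c (s + t) : H →L[ℂ] H) (V t (π b Ω)) -
          ψ b • (c (s + t) : H →L[ℂ] H) Ω)⟫_ℂ := by
      intro t
      rw [← emb_add hlam s t, hωa, show π (lam t b) Ω = V t (π b Ω) from
          ((hV t).apply_vec b).symm, inner_sub_left, inner_star_apply_left, map_sub,
        map_smul, inner_sub_right, inner_smul_right,
        apply_comm_of_mem (ha _) (corner_le π Ω (c (s + t)).2)]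
      ring
    have h₂ : Tendsto (fun t => ω (emb hlam (-(s : T)) b) - ψ b * m (s + t)) atTop (𝓝 0) := by
      simp only [h₁]
      rw [← add_zero (0 : ℂ)]
      refine Tendsto.add ?_ ?_
      · refine squeeze_zero_norm (a := fun t => ‖Ω - star (c (s + t) : H →L[ℂ] H)
          ((c (s + t) : H →L[ℂ] H) Ω)‖ * ‖π b Ω‖) (fun t => ?_) ?_
        · refine (norm_inner_le_norm _ _).trans (mul_le_mul_of_nonneg_left ?_ (norm_nonneg _))
          exact (hbdd _ _).trans_eq ((hV t).norm_map _)
        · simpa using (hcΩ s).norm.mul_const ‖π b Ω‖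
      · refine squeeze_zero_norm (a := fun t => ‖(c (s + t) : H →L[ℂ] H) (V t (π b Ω)) -
          ψ b • (c (s + t) : H →L[ℂ] H) Ω‖) (fun t => ?_) ?_
        · refine (norm_inner_le_norm _ _).trans ?_
          refine (mul_le_mul ((hcbdd _ _).trans_eq hΩ) (hbdd _ _) (norm_nonneg _)
            zero_le_one).trans_eq (one_mul _)
        · simpa using (hcV s b).norm
    simpa using h₂.const_sub (ω (emb hlam (-(s : T)) b))
  obtain ⟨b₀, hb₀⟩ : ∃ b, ψ b ≠ 0 := by
    by_contra! h₀
    have h₁ := hψ.2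
    rw [show ψ = 0 from ContinuousLinearMap.ext h₀, norm_zero] at h₁
    exact zero_ne_one h₁
  -- Since m involves neither s nor b, its limit is determined at s = 0 by a single b₀ with ψ(b₀) ≠
  -- 0.
  set L := ω (emb hlam (-((0 : {t : T // 0 ≤ t}) : T)) b₀) / ψ b₀ with hL
  have hmL : Tendsto m atTop (𝓝 L) := by
    have h₁ := (hm 0 b₀).div_const (ψ b₀)
    simpa [hL, mul_div_cancel_left₀ _ hb₀] using h₁
  refine ⟨L, inductiveLimit_functional_ext hlam fun s b => ?_⟩
  change _ = L * limitState hlam ψ hinv (emb hlam (-(s : T)) b)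
  rw [limitState_emb, mul_comm]
  have hst : Tendsto (fun t : {t : T // 0 ≤ t} => s + t) atTop atTop :=
    tendsto_atTop_mono (fun t => le_add_of_nonneg_left s.2) tendsto_id
  exact tendsto_nhds_unique (hm s b) ((hmL.comp hst).const_mul (ψ b))

end Limit

/-! ### Decreasing projections and diagonal selection. -/

section Auxiliary

/-- Projections onto an antitone family of closed subspaces converge strongly. -/
theorem exists_tendsto_starProjection_of_antitone {E : Type*} [NormedAddCommGroup E]
    [InnerProductSpace ℂ E] [CompleteSpace E] {ι : Type*} [Preorder ι] (K : ι → Submodule ℂ E)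
    [∀ i, (K i).HasOrthogonalProjection] (hK : Antitone K) (x : E) :
    ∃ y, Tendsto (fun i => (K i).starProjection x) atTop (𝓝 y) := by
  have : CompleteSpace (⨆ i, (K i)ᗮ).topologicalClosure :=
    inferInstanceAs (CompleteSpace (Submodule.topologicalClosure _))
  have h := Submodule.starProjection_tendsto_closure_iSup (fun i => (K i)ᗮ)
    (fun i j hij => Submodule.orthogonal_le (hK hij)) x
  refine ⟨_, (h.const_sub x).congr fun i => ?_⟩
  rw [Submodule.starProjection_orthogonal']
  exact sub_sub_cancel _ _

/-- Diagonal selection: properties `G m` that can each be satisfied eventually can be satisfied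
eventually for arbitrarily large `m` by a single choice. -/
theorem exists_diagonal {ι γ : Type*} [Nonempty γ] {l : Filter ι} {N : ι → ℕ}
    (hN : Tendsto N l atTop) {G : ℕ → ι → γ → Prop} (hG : ∀ m, ∀ᶠ u in l, ∃ c, G m u c) :
    ∃ c : ι → γ, ∀ m₀, ∀ᶠ u in l, ∃ m, m₀ ≤ m ∧ G m u (c u) := by
  classical
  -- The largest satisfiable index up to N(u). `Nat.findGreatest` defaults to 0 even when nothing is
  -- satisfiable, hence the conditional form of the next statement.
  let n : ι → ℕ := fun u => Nat.findGreatest (fun m => ∃ c, G m u c) (N u)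
  have : ∀ u, ∃ c, (∃ c, G (n u) u c) → G (n u) u c := fun u => by
    by_cases h : ∃ c, G (n u) u c
    · exact ⟨h.choose, fun _ => h.choose_spec⟩
    · exact ⟨Classical.arbitrary γ, fun h' => absurd h' h⟩
  choose c hc using this
  refine ⟨c, fun m₀ => ?_⟩
  filter_upwards [hG m₀, hN.eventually_ge_atTop m₀] with u hu hu'
  exact ⟨n u, Nat.le_findGreatest hu' hu,
    hc u (Nat.findGreatest_spec (P := fun m => ∃ c, G m u c) hu' hu)⟩

end Auxiliary

/-! ### The weak Kolmogorov property from purity. -/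

section Converse

variable {T : Type*} [AddCommGroup T] [LinearOrder T] [IsOrderedAddMonoid T]
variable {B : Type*} [NonUnitalCStarAlgebra B]
variable {lam : {t : T // 0 ≤ t} → (B →⋆ₙₐ[ℂ] B)} {hlam : IsInjectiveSemigroup lam}
variable {H : Type*} [NormedAddCommGroup H] [InnerProductSpace ℂ H] [CompleteSpace H]
variable {ψ : B →L[ℂ] ℂ} {π : B →⋆ₙₐ[ℂ] (H →L[ℂ] H)} {Ω : H}
  {V : {t : T // 0 ≤ t} → (H →L[ℂ] H)}

open InductiveLimit

theorem apply_add_of_implementing (hlam : IsInjectiveSemigroup lam) (h : IsGNSTriple ψ π Ω)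
    (hV : ∀ t, IsIntertwiningIsometry π Ω (π.comp (lam t)) Ω (V t)) (r s : {t : T // 0 ≤ t})
    (x : H) : V (r + s) x = V r (V s x) := by
  have : V (r + s) = V r ∘L V s := h.ext_operator fun b => by
    rw [ContinuousLinearMap.comp_apply, (hV _).apply_vec, (hV s).apply_vec]
    change _ = V r (π (lam s b) Ω)
    rw [(hV r).apply_vec]
    exact congrArg (fun a => π a Ω) (hlam.map_add r s b)
  rw [this]
  rfl

/-- The selfadjoint elements of the increasing union are dense in the selfadjoint elements of the
inductive limit. -/
theorem exists_isSelfAdjoint_emb_norm_sub_lt {x : InductiveLimit hlam} (hx : IsSelfAdjoint x)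
    {ε : ℝ} (hε : 0 < ε) : ∃ d ∈ ⋃ u : {t : T // 0 ≤ t}, Set.range (emb hlam (-(u : T))),
      IsSelfAdjoint d ∧ ‖d - x‖ < ε := by
  obtain ⟨_, ⟨_, ⟨u, rfl⟩, b, rfl⟩, hb⟩ :=
    Metric.mem_closure_iff.1 (dense_iUnion_range_emb hlam x) ε hε
  rw [dist_comm, dist_eq_norm] at hb
  set d := emb hlam (-(u : T)) b with hd
  refine ⟨(2⁻¹ : ℂ) • (d + star d), Set.mem_iUnion.2 ⟨u, (2⁻¹ : ℂ) • (b + star b), ?_⟩, ?_, ?_⟩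
  · rw [map_smul, map_add, map_star]
  · rw [isSelfAdjoint_iff, star_smul, star_add, star_star, add_comm]
    simp
  · have h₁ : (2⁻¹ : ℂ) • (d + star d) - x = (2⁻¹ : ℂ) • ((d - x) + star (d - x)) := by
      have h₂ : x = (2⁻¹ : ℂ) • (x + x) := by
        rw [← two_smul ℂ, smul_smul, inv_mul_cancel₀ two_ne_zero, one_smul]
      rw [star_sub, hx.star_eq]
      nth_rewrite 1 [h₂]
      rw [← smul_sub]
      congr 1
      abel
    rw [h₁, norm_smul]
    have h₂ : ‖(d - x) + star (d - x)‖ ≤ ‖d - x‖ + ‖d - x‖ :=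
      (norm_add_le _ _).trans_eq (by rw [norm_star])
    have h₃ : ‖(2⁻¹ : ℂ)‖ = 2⁻¹ := by simp
    rw [h₃]
    linarith

/-- For a pure state on the inductive limit, contractions from the increasing union approximate the
projection onto the cyclic vector of the GNS representation. -/
theorem exists_filter_tendsto_rankOne {E : Type*} [NormedAddCommGroup E] [InnerProductSpace ℂ E]
    [CompleteSpace E] {Ψ : InductiveLimit hlam →L[ℂ] ℂ}
    {ρ : InductiveLimit hlam →⋆ₙₐ[ℂ] (E →L[ℂ] E)} {ξ : E} (h : IsGNSTriple Ψ ρ ξ)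
    (hΨ : IsPureState Ψ) :
    ∃ l : Filter (InductiveLimit hlam), l.NeBot ∧
      (∀ᶠ f in l, f ∈ (⋃ u : {t : T // 0 ≤ t}, Set.range (emb hlam (-(u : T)))) ∧ ‖f‖ ≤ 1) ∧
      ∀ η, Tendsto (fun f => ρ f η) l (𝓝 (⟪ξ, η⟫_ℂ • ξ)) := by
  have hξ : ‖ξ‖ = 1 := h.norm_eq_one hΨ.1
  let p : E →L[ℂ] E := InnerProductSpace.rankOne ℂ ξ ξ
  have hp : ∀ η, p η = ⟪ξ, η⟫_ℂ • ξ := fun η => InnerProductSpace.rankOne_apply ..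
  have hpp : p * p = p := by
    ext η
    change p (p η) = p η
    rw [hp η, map_smul, hp ξ, inner_self_eq_norm_sq_to_K, hξ]
    simp
  have hps : IsSelfAdjoint p := by
    rw [isSelfAdjoint_iff]
    refine ContinuousLinearMap.ext fun η => ext_inner_left ℂ fun ζ => ?_
    rw [inner_star_apply, hp, hp, inner_smul_left, inner_smul_right, inner_conj_symm, mul_comm]
  -- Irreducibility: the commutant consists of scalars, so every operator belongs to the
  -- bicommutant.
  have hpm : p ∈ piBicommutant ρ := mem_piBicommutant.2 fun a ha => by
    obtain ⟨z, rfl⟩ := h.exists_eq_smul_one hΨ ha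
    rw [smul_mul_assoc, mul_smul_comm, one_mul, mul_one]
  -- The transform is formed inside B at a fixed time, so it does not leave the union, although the
  -- union need not be complete.
  have hDf : ∀ d ∈ ⋃ u : {t : T // 0 ≤ t}, Set.range (emb hlam (-(u : T))), IsSelfAdjoint d →
      ∃ f ∈ ⋃ u : {t : T // 0 ≤ t}, Set.range (emb hlam (-(u : T))),
        ‖f‖ ≤ 1 ∧ f + d * d * f = d + d := by
    rintro _ ⟨_, ⟨u, rfl⟩, b, rfl⟩ hb
    have hb' : IsSelfAdjoint b := (isInductiveLimit hlam).injective (-(u : T)) (by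
      rw [map_star]; exact hb)
    obtain ⟨f, hf₁, hf₂, -⟩ := exists_boundedTransform hb'
    refine ⟨emb hlam (-(u : T)) f, Set.mem_iUnion.2 ⟨u, f, rfl⟩,
      (NonUnitalStarAlgHom.norm_apply_le _ f).trans hf₁, ?_⟩
    rw [← map_mul, ← map_mul, ← map_add, hf₂, map_add]
  -- A projection is its own bounded transform, since 2t/(1+t²) fixes 0 and 1.
  obtain ⟨l, hl, hl₁, hlim⟩ := exists_filter_boundedTransform
    (fun ζ => h.eq_zero_of_forall_apply_eq_zero) hpm hps (G := p) (by rw [hpp, hpp])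
    (D := ⋃ u : {t : T // 0 ≤ t}, Set.range (emb hlam (-(u : T)))) hDf
    (fun x hx ε hε => exists_isSelfAdjoint_emb_norm_sub_lt hx hε)
  refine ⟨l, hl, hl₁, fun η => ?_⟩
  rw [← hp]
  exact hlim η

/-- The isometries that realize the GNS spaces of the increasing subalgebras in the GNS space of
the inductive limit state. -/
theorem exists_isometry_inductiveLimit (h : IsGNSTriple ψ π Ω) (hinv : ∀ t b, ψ (lam t b) = ψ b)
    (hΩ : ‖Ω‖ = 1) {E : Type*} [NormedAddCommGroup E] [InnerProductSpace ℂ E]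
    [CompleteSpace E] {ρ : InductiveLimit hlam →⋆ₙₐ[ℂ] (E →L[ℂ] E)} {ξ : E}
    (hρ : IsGNSTriple (limitState hlam ψ hinv) ρ ξ) (hξ : ‖ξ‖ = 1) :
    ∃ U : {t : T // 0 ≤ t} → (H →L[ℂ] E), ∀ u : {t : T // 0 ≤ t},
      IsIntertwiningIsometry π Ω (ρ.comp (emb hlam (-(u : T)))) ξ (U u) := by
  choose U hU using fun u : {t : T // 0 ≤ t} =>
    h.exists_isIntertwiningIsometry (ρ := ρ.comp (emb hlam (-(u : T)))) (ξ := ξ)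
      (fun b => (hρ.inner_eq _).trans (limitState_emb ψ hinv _ b)) (hξ.trans hΩ.symm)
  exact ⟨U, hU⟩

/-- If the inductive limit state is pure, then eventually there are contractions in the corner that
act on given vectors nearly as the projection onto `Ω`. -/
theorem eventually_exists_contraction (hψ : ψ ∈ stateSpace B) (hinv : ∀ t b, ψ (lam t b) = ψ b)
    (h : IsGNSTriple ψ π Ω) (hV : ∀ t, IsIntertwiningIsometry π Ω (π.comp (lam t)) Ω (V t))
    (hpure : IsPureState (limitState hlam ψ hinv)) {ι : Type*} (s : Finset ι)
    (w : ι → {t : T // 0 ≤ t}) (κ : ι → H) {ε : ℝ} (hε : 0 < ε) :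
    ∀ᶠ u in atTop, ∃ c : {c : corner π Ω // ‖(c : H →L[ℂ] H)‖ ≤ 1}, ∀ k ∈ s, ∀ r, w k + r = u →
      ‖(c.1 : H →L[ℂ] H) (V r (κ k)) - ⟪Ω, κ k⟫_ℂ • Ω‖ < ε := by
  obtain ⟨E, _, _, _, ρ, ξ, hρ⟩ := exists_isGNSTriple hpure.1.1
  have hξ : ‖ξ‖ = 1 := hρ.norm_eq_one hpure.1
  obtain ⟨U, hU⟩ := exists_isometry_inductiveLimit h hinv (h.norm_eq_one hψ) hρ hξ
  have hUV : ∀ w r x, U (w + r) (V r x) = U w x := by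
    intro w r x
    have : U (w + r) ∘L V r = U w := h.ext_operator fun b => by
      rw [ContinuousLinearMap.comp_apply, (hV r).apply_vec, (hU w).apply_vec]
      change U (w + r) (π (lam r b) Ω) = _
      rw [(hU _).apply_vec]
      exact congrArg (fun a => ρ a ξ) (emb_add hlam w r b)
    rw [← this]
    rfl
  let K : {t : T // 0 ≤ t} → Submodule ℂ E := fun u =>
    supportSpace (ρ.comp (emb hlam (-(u : T)))) ξ
  have hK : Antitone K := by
    intro w u hwu
    obtain ⟨r, rfl⟩ : ∃ r, u = w + r := ⟨⟨u.1 - w.1, sub_nonneg.2 hwu⟩, Subtype.ext (by simp)⟩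
    have h₁ : ρ.comp (emb hlam (-(w : T))) =
        (ρ.comp (emb hlam (-((w + r : {t : T // 0 ≤ t}) : T)))).comp (lam r) := by
      ext b : 1
      exact congrArg ρ (emb_add hlam w r b).symm
    simp only [K]
    rw [h₁]
    exact supportSpace_le_comp (lam r)
  -- The projected vectors vary with u, whereas strong convergence is available only at fixed
  -- vectors. Their limits e_k play that role: the contraction f is chosen for the e_k first, and u
  -- is taken large afterwards.
  choose e he using fun k =>
    exists_tendsto_starProjection_of_antitone K hK (U (w k) (κ k))
  have hinner : ∀ k, ⟪ξ, e k⟫_ℂ = ⟪Ω, κ k⟫_ℂ := by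
    intro k
    refine tendsto_nhds_unique (tendsto_const_nhds.inner (he k)) ?_
    refine tendsto_const_nhds.congr fun u => ?_
    change _ = ⟪ξ, supportProj (ρ.comp (emb hlam (-(u : T)))) ξ _⟫_ℂ
    rw [inner_supportProj, supportProj_self, ← (hU (w k)).map_vec, (hU (w k)).inner_map_map]
  obtain ⟨l, hl, hl₁, hlim⟩ := exists_filter_tendsto_rankOne hρ hpure
  have hev : ∀ᶠ f in l, ∀ k ∈ s, ‖ρ f (e k) - ⟪ξ, e k⟫_ℂ • ξ‖ < ε / 2 :=
    (Finset.eventually_all s).2 fun k _ => by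
      have := Metric.tendsto_nhds.1 (hlim (e k)) (ε / 2) (half_pos hε)
      simpa only [dist_eq_norm] using this
  obtain ⟨_, ⟨⟨_, ⟨w₀, rfl⟩, b₀, rfl⟩, hb₀⟩, hb₁⟩ := (hl₁.and hev).exists
  replace hb₀ : ‖b₀‖ ≤ 1 := by
    rwa [NonUnitalStarAlgHom.norm_map _ ((isInductiveLimit hlam).injective _)] at hb₀
  have hev' : ∀ᶠ u in atTop, ∀ k ∈ s, ‖(K u).starProjection (U (w k) (κ k)) - e k‖ < ε / 2 :=
    (Finset.eventually_all s).2 fun k _ => by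
      have := Metric.tendsto_nhds.1 (he k) (ε / 2) (half_pos hε)
      simpa only [dist_eq_norm] using this
  filter_upwards [hev', eventually_ge_atTop w₀] with u hu hwu
  obtain ⟨q, rfl⟩ : ∃ q, u = w₀ + q := ⟨⟨u.1 - w₀.1, sub_nonneg.2 hwu⟩, Subtype.ext (by simp)⟩
  -- The element f seen from the later index w₀ + q; its compression to the corner is the
  -- contraction sought.
  set b := lam q b₀ with hb
  have hbn : ‖π b‖ ≤ 1 := (NonUnitalStarAlgHom.norm_apply_le π b).trans
    ((NonUnitalStarAlgHom.norm_apply_le _ b₀).trans hb₀)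
  refine ⟨⟨⟨_, compress_mem_corner b⟩, ?_⟩, fun k hk r hr => ?_⟩
  · refine (norm_mul_le _ _).trans (mul_le_one₀ ?_ (norm_nonneg _) norm_supportProj_le)
    exact (norm_mul_le _ _).trans (mul_le_one₀ norm_supportProj_le (norm_nonneg _) hbn)
  · set u := w₀ + q
    let Q : E →L[ℂ] E := supportProj (ρ.comp (emb hlam (-(u : T)))) ξ
    have hρb : ∀ x, ρ (emb hlam (-(u : T)) b) x = ρ (emb hlam (-(w₀ : T)) b₀) x := fun x =>
      congrArg (fun a => ρ a x) (emb_add hlam w₀ q b₀)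
    -- Carried to E, the error splits into the distance of the projected vector from e_k and the
    -- failure of ρ(f) to act on e_k as the rank-one projection.
    have h₁ : U u (supportProj π Ω (π b (supportProj π Ω (V r (κ k)))) - ⟪Ω, κ k⟫_ℂ • Ω) =
        Q (ρ (emb hlam (-(w₀ : T)) b₀) (Q (U (w k) (κ k)) - e k)) +
          Q (ρ (emb hlam (-(w₀ : T)) b₀) (e k) - ⟪ξ, e k⟫_ℂ • ξ) := by
      have h₂ : Q ξ = ξ := supportProj_self
      have h₃ : U u (V r (κ k)) = U (w k) (κ k) := by rw [← hr, hUV]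
      rw [map_sub, (hU u).map_supportProj, (hU u).comm, (hU u).map_supportProj, map_smul,
        (hU u).map_vec, h₃, map_sub, map_sub, map_sub, map_smul, h₂, hinner]
      change Q (ρ (emb hlam (-(u : T)) b) (Q (U (w k) (κ k)))) - _ = _
      rw [hρb]
      abel
    have h₂ : ‖Q (ρ (emb hlam (-(w₀ : T)) b₀) (Q (U (w k) (κ k)) - e k))‖ < ε / 2 := by
      refine lt_of_le_of_lt ?_ (hu k hk)
      refine (norm_supportProj_apply_le _).trans ((norm_map_apply_le ρ _ _).trans ?_)
      refine mul_le_of_le_one_left (norm_nonneg _) ?_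
      exact (NonUnitalStarAlgHom.norm_apply_le _ b₀).trans hb₀
    have h₃ : ‖Q (ρ (emb hlam (-(w₀ : T)) b₀) (e k) - ⟪ξ, e k⟫_ℂ • ξ)‖ < ε / 2 :=
      (norm_supportProj_apply_le _).trans_lt (hb₁ k hk)
    rw [← (hU u).norm_map]
    change ‖U u (supportProj π Ω (π b (supportProj π Ω (V r (κ k)))) - ⟪Ω, κ k⟫_ℂ • Ω)‖ < ε
    rw [h₁]
    exact (norm_add_le _ _).trans_lt (by linarith)

/-- Contractions that asymptotically act as the projection onto `Ω` give the weak Kolmogorov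
property. -/
theorem isWeaklyKolmogorov_of_tendsto (h : IsGNSTriple ψ π Ω) (hΩ : ‖Ω‖ = 1)
    (hV : ∀ t, IsIntertwiningIsometry π Ω (π.comp (lam t)) Ω (V t))
    {c : {t : T // 0 ≤ t} → corner π Ω} (hc : ∀ t, ‖(c t : H →L[ℂ] H)‖ ≤ 1)
    (hlim : ∀ (s : {t : T // 0 ≤ t}) (x : H),
      Tendsto (fun t => (c (s + t) : H →L[ℂ] H) (V t x)) atTop (𝓝 (⟪Ω, x⟫_ℂ • Ω))) :
    IsWeaklyKolmogorov π Ω lam := by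
  refine (isWeaklyKolmogorov_iff h hV).2 ⟨c, hc, fun s x y => ?_⟩
  have h₁ := (hlim s (star (x : H →L[ℂ] H) Ω)).inner (𝕜 := ℂ) (hlim s ((y : H →L[ℂ] H) Ω))
  rwa [inner_smul_left, inner_smul_right, inner_self_eq_norm_sq_to_K, hΩ, inner_conj_symm,
    RCLike.ofReal_one, one_pow, mul_one] at h₁

/-- In the trivial case of a one-point time axis, the projection onto `Ω` lies in the corner. -/
theorem isWeaklyKolmogorov_of_subsingleton [Subsingleton T] (hψ : ψ ∈ stateSpace B)
    (hinv : ∀ t b, ψ (lam t b) = ψ b) (h : IsGNSTriple ψ π Ω)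
    (hpure : IsPureState (limitState hlam ψ hinv)) : IsWeaklyKolmogorov π Ω lam := by
  obtain ⟨V, hV⟩ := h.exists_implementing hinv
  have hΩ : ‖Ω‖ = 1 := h.norm_eq_one hψ
  obtain ⟨E, _, _, _, ρ, ξ, hρ⟩ := exists_isGNSTriple hpure.1.1
  have hξ : ‖ξ‖ = 1 := hρ.norm_eq_one hpure.1
  obtain ⟨U, hU⟩ := exists_isometry_inductiveLimit h hinv hΩ hρ hξ
  -- With a single time, B has dense image in the limit, so the commutant of π embeds by conjugation
  -- into that of the irreducible ρ.
  have hscalar : ∀ a ∈ piCommutant π, ∃ z : ℂ, a = z • 1 := by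
    intro a ha
    have h₁ := (hU 0).conj_mem ha
    have h₂ : U 0 ∘L a ∘L ContinuousLinearMap.adjoint (U 0) ∈ piCommutant ρ := by
      refine mem_piCommutant.2 (inductiveLimit_induction hlam ?_ fun u b => ?_)
      · have hρc : Continuous ρ := AddMonoidHomClass.continuous_of_bound ρ 1 fun b => by
          rw [one_mul]
          exact NonUnitalStarAlgHom.norm_apply_le ρ b
        exact isClosed_eq (hρc.mul continuous_const) (continuous_const.mul hρc)
      · rw [Subsingleton.elim u 0]
        exact mem_piCommutant.1 h₁ b
    obtain ⟨z, hz⟩ := hρ.exists_eq_smul_one hpure h₂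
    refine ⟨z, ContinuousLinearMap.ext fun x => ?_⟩
    have h₃ := congrArg (fun S : E →L[ℂ] E => ContinuousLinearMap.adjoint (U 0) (S (U 0 x))) hz
    simp only [ContinuousLinearMap.comp_apply, (hU 0).adjoint_apply_map] at h₃
    rw [h₃, _root_.smul_apply, map_smul]
    exact congrArg (z • ·) ((hU 0).adjoint_apply_map x)
  let p : H →L[ℂ] H := InnerProductSpace.rankOne ℂ Ω Ω
  have hp : ∀ η, p η = ⟪Ω, η⟫_ℂ • Ω := fun η => InnerProductSpace.rankOne_apply ..
  have hpm : p ∈ corner π Ω := by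
    refine mem_corner_iff.2 ⟨mem_piBicommutant.2 fun a ha => ?_, ?_, ?_⟩
    · obtain ⟨z, rfl⟩ := hscalar a ha
      rw [smul_mul_assoc, mul_smul_comm, one_mul, mul_one]
    · ext x
      change supportProj π Ω (p x) = p x
      rw [hp, map_smul, supportProj_self]
    · ext x
      change p (supportProj π Ω x) = p x
      rw [hp, hp, inner_supportProj, supportProj_self]
  refine isWeaklyKolmogorov_of_tendsto h hΩ hV (c := fun _ => ⟨p, hpm⟩) (fun _ => ?_)
    fun s x => tendsto_const_nhds.congr fun t => ?_
  · refine p.opNorm_le_bound zero_le_one fun x => ?_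
    rw [hp, norm_smul, hΩ, mul_one, one_mul]
    exact (norm_inner_le_norm _ _).trans_eq (by rw [hΩ, one_mul])
  · change _ = p (V t x)
    rw [hp, ← (hV t).inner_map_map Ω x, (hV t).map_vec]

/-- In a nontrivial Archimedean group, there is a map from the positive cone to the natural numbers
that tends to infinity. -/
theorem exists_tendsto_nat [Archimedean T] {a : T} (ha : 0 < a) :
    ∃ N : {t : T // 0 ≤ t} → ℕ, Tendsto N atTop atTop := by
  choose N hN using fun u : {t : T // 0 ≤ t} => Archimedean.arch (u : T) ha
  refine ⟨N, tendsto_atTop.2 fun m => ?_⟩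
  filter_upwards [eventually_ge_atTop (⟨m • a, nsmul_nonneg ha.le m⟩ : {t : T // 0 ≤ t})] with u hu
  exact (nsmul_le_nsmul_iff_left ha).1 ((show m • a ≤ (u : T) from hu).trans (hN u))

/-- If the inductive limit state is pure and the support space is separable, then the weak
Kolmogorov property holds. -/
theorem isWeaklyKolmogorov_of_isPureState [Archimedean T] (hψ : ψ ∈ stateSpace B)
    (hinv : ∀ t b, ψ (lam t b) = ψ b) (h : IsGNSTriple ψ π Ω)
    (hsep : TopologicalSpace.SeparableSpace (supportSpace π Ω))
    (hpure : IsPureState (limitState hlam ψ hinv)) : IsWeaklyKolmogorov π Ω lam := by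
  -- On a one-point time axis no map to ℕ tends to infinity, so the diagonal selection is
  -- unavailable there.
  rcases subsingleton_or_nontrivial T with hT | hT
  · exact isWeaklyKolmogorov_of_subsingleton hψ hinv h hpure
  obtain ⟨V, hV⟩ := h.exists_implementing hinv
  have hΩ : ‖Ω‖ = 1 := h.norm_eq_one hψ
  obtain ⟨a, ha⟩ := exists_zero_lt (α := T)
  obtain ⟨N, hN⟩ := exists_tendsto_nat ha
  let W : ℕ → {t : T // 0 ≤ t} := fun n => ⟨n • a, nsmul_nonneg ha.le n⟩
  let κ : ℕ → supportSpace π Ω := TopologicalSpace.denseSeq _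
  have : Nonempty {c : corner π Ω // ‖(c : H →L[ℂ] H)‖ ≤ 1} := ⟨0, by simp⟩
  -- The m-th property handles the pairs (n, j) with code at most m, meaning time n•a and the j-th
  -- dense vector, to precision 1/(m+1).
  obtain ⟨c, hc⟩ := exists_diagonal (γ := {c : corner π Ω // ‖(c : H →L[ℂ] H)‖ ≤ 1}) hN
    (G := fun m u c => ∀ k ∈ Finset.range (m + 1), ∀ r, W k.unpair.1 + r = u →
      ‖(c.1 : H →L[ℂ] H) (V r (κ k.unpair.2)) - ⟪Ω, (κ k.unpair.2 : H)⟫_ℂ • Ω‖ <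
        1 / ((m : ℝ) + 1))
    fun m => eventually_exists_contraction hψ hinv h hV hpure _ (fun k : ℕ => W k.unpair.1)
      (fun k => (κ k.unpair.2 : H)) (ε := 1 / ((m : ℝ) + 1)) (by positivity)
  have hcbdd : ∀ u x, ‖((c u).1 : H →L[ℂ] H) x‖ ≤ ‖x‖ := fun u x =>
    (((c u).1 : H →L[ℂ] H).le_of_opNorm_le (c u).2 x).trans_eq (one_mul _)
  have hK : ∀ (n : ℕ) (x : supportSpace π Ω) (ε : ℝ), 0 < ε → ∀ᶠ u in atTop, ∀ r, W n + r = u →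
      ‖((c u).1 : H →L[ℂ] H) (V r x) - ⟪Ω, (x : H)⟫_ℂ • Ω‖ < ε := by
    intro n x ε hε
    obtain ⟨j, hj⟩ := Metric.denseRange_iff.1 (TopologicalSpace.denseRange_denseSeq _) x (ε / 3)
      (by positivity)
    replace hj : ‖(x : H) - κ j‖ < ε / 3 := by rw [← dist_eq_norm]; exact hj
    obtain ⟨m₁, hm₁⟩ := exists_nat_one_div_lt (show 0 < ε / 3 by positivity)
    -- The index must be large enough both to include the pair (n, j) and to make the precision
    -- smaller than ε/3.
    filter_upwards [hc (max m₁ (Nat.pair n j))] with u ⟨m, hm, hu⟩ r hr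
    have h₁ := hu (Nat.pair n j) (Finset.mem_range_succ_iff.2 ((le_max_right _ _).trans hm)) r
    rw [Nat.unpair_pair] at h₁
    have h₂ : ‖((c u).1 : H →L[ℂ] H) (V r (κ j)) - ⟪Ω, (κ j : H)⟫_ℂ • Ω‖ < ε / 3 :=
      (h₁ hr).trans_le ((one_div_le_one_div_of_le (by positivity)
        (by exact_mod_cast Nat.succ_le_succ ((le_max_left _ _).trans hm))).trans hm₁.le)
    have h₃ : ‖((c u).1 : H →L[ℂ] H) (V r ((x : H) - κ j))‖ < ε / 3 :=
      ((hcbdd u _).trans_eq ((hV r).norm_map _)).trans_lt hj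
    have h₄ : ‖⟪Ω, (x : H) - κ j⟫_ℂ • Ω‖ < ε / 3 := by
      rw [norm_smul, hΩ, mul_one]
      exact ((norm_inner_le_norm _ _).trans_eq (by rw [hΩ, one_mul])).trans_lt hj
    have h₅ : ((c u).1 : H →L[ℂ] H) (V r x) - ⟪Ω, (x : H)⟫_ℂ • Ω =
        ((c u).1 : H →L[ℂ] H) (V r ((x : H) - κ j)) +
          (((c u).1 : H →L[ℂ] H) (V r (κ j)) - ⟪Ω, (κ j : H)⟫_ℂ • Ω) -
          ⟪Ω, (x : H) - κ j⟫_ℂ • Ω := by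
      rw [map_sub, map_sub, inner_sub_right, sub_smul]
      abel
    have h₆ := norm_add_le (((c u).1 : H →L[ℂ] H) (V r ((x : H) - κ j)))
      (((c u).1 : H →L[ℂ] H) (V r (κ j)) - ⟪Ω, (κ j : H)⟫_ℂ • Ω)
    rw [h₅]
    exact (norm_sub_le _ _).trans_lt (by linarith)
  refine isWeaklyKolmogorov_of_tendsto h hΩ hV (c := fun u => (c u).1) (fun u => (c u).2)
    fun s x => ?_
  obtain ⟨n, hn⟩ := Archimedean.arch (s : T) ha
  -- An arbitrary s is reduced to a multiple of a beyond it: for t = r + r₀ one has s + t = n•a + r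
  -- and V_t x = V_r V_{r₀} x.
  obtain ⟨r₀, hr₀⟩ : ∃ r₀, W n = s + r₀ := ⟨⟨n • a - s, sub_nonneg.2 hn⟩, Subtype.ext (by simp [W])⟩
  -- Because cV_r = cV_rP, only the part of V_{r₀}x in K matters; hence separability of K suffices.
  let y : supportSpace π Ω := ⟨_, supportProj_apply_mem (V r₀ x)⟩
  have hy : ⟪Ω, (y : H)⟫_ℂ = ⟪Ω, x⟫_ℂ := by
    change ⟪Ω, supportProj π Ω (V r₀ x)⟫_ℂ = _
    rw [inner_supportProj, supportProj_self, ← (hV r₀).inner_map_map Ω x, (hV r₀).map_vec]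
  have hst : Tendsto (fun t : {t : T // 0 ≤ t} => s + t) atTop atTop :=
    tendsto_atTop_mono (fun t => le_add_of_nonneg_left s.2) tendsto_id
  rw [Metric.tendsto_nhds]
  intro ε hε
  filter_upwards [hst.eventually (hK n y ε hε), eventually_ge_atTop r₀] with t ht hrt
  obtain ⟨r, rfl⟩ : ∃ r, t = r + r₀ := ⟨⟨t.1 - r₀.1, sub_nonneg.2 hrt⟩, Subtype.ext (by simp)⟩
  have h₁ := ht r (by rw [hr₀, add_assoc, add_comm r₀])
  have hcm := (c (s + (r + r₀))).1.2
  rw [dist_eq_norm, apply_add_of_implementing hlam h hV, ← apply_supportProj_of_mem_corner hcm,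
    ← (hV r).supportProj_apply, apply_supportProj_of_mem_corner hcm, ← hy]
  exact h₁

end Converse

end WeakKolmogorov

open WeakKolmogorov in
theorem theorem3p2
    {T : Type*} [AddCommGroup T] [LinearOrder T] [IsOrderedAddMonoid T] [Archimedean T]
    {B₀ : Type*} [NonUnitalCStarAlgebra B₀]
    (lam : {t : T // 0 ≤ t} → (B₀ →⋆ₙₐ[ℂ] B₀)) (hlam : IsInjectiveSemigroup lam)
    (ψ : B₀ →L[ℂ] ℂ) (hψ : ψ ∈ stateSpace B₀) (hinv : ∀ t b, ψ (lam t b) = ψ b)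
    {H : Type*} [NormedAddCommGroup H] [InnerProductSpace ℂ H] [CompleteSpace H]
    (π : B₀ →⋆ₙₐ[ℂ] (H →L[ℂ] H)) (Ω : H) (hGNS : IsGNSTriple ψ π Ω) :
    (IsWeaklyKolmogorov π Ω lam → IsPureState (InductiveLimit.limitState hlam ψ hinv)) ∧
    (TopologicalSpace.SeparableSpace (supportSpace π Ω) →
      (IsPureState (InductiveLimit.limitState hlam ψ hinv) ↔ IsWeaklyKolmogorov π Ω lam)) :=
  ⟨IsWeaklyKolmogorov.isPureState hlam hψ hinv hGNS, fun hsep =>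
    ⟨isWeaklyKolmogorov_of_isPureState hψ hinv hGNS hsep,
      IsWeaklyKolmogorov.isPureState hlam hψ hinv hGNS⟩⟩
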